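/- **Setting.** For a real matrix $A$ let $\|A\|_2$ be its spectral norm and $\|A\|_{2,1}$ the sum of the Euclidean norms of its columns. Let $\sigma:\mathbb R\to\mathbb R$ be $L_\sigma$-Lipschitz with $\sigma(0)=0$ (applied entrywise), and let $\Pi_{\rm norm}$ project every row of a matrix onto the closed Euclidean unit ball. For weights $W=(W_Q,W_K,W_V,W_C)$ with $W_Q,W_K,W_V\in\mathbb R^{d\times k}$, $W_C\in\mathbb R^{k\times d}$, a Transformer block maps $Z\in\mathbb R^{T\times d}$ to $$\Pi_{\rm norm}\Big(\sigma\big(\Pi_{\rm norm}\big(\mathrm{RowSoftmax}(ZW_Q(ZW_K)^\top)\,ZW_V\big)\big)W_C\Big)\in\mathbb R^{T\times d}.$$ Let $g(X;W^{(1)},\dots,W^{(L)})$ be the composition of $L$ such blocks (block $1$ first), let $[\mathrm{CLS}]$ be a fixed one of the $T$ positions, and let $\mathcal F$ be the class of functions $X\mapsto w^\top g(X;W^{(1)},\dots,W^{(L)})_{[\mathrm{CLS}],:}$ with $\|w\|_2\le B_w$ and, for all $i\le L$, $$\|W_K^{(i)}W_Q^{(i)\top}\|_2\le B_{QK}^{(i)},\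 \|W_V^{(i)}\|_2\le B_V^{(i)},\ \|W_C^{(i)}\|_2\le B_C^{(i)},$$ $$\|W_K^{(i)}W_Q^{(i)\top}\|_{2,1}\le B_{QK}^{2,1,(i)},\ \|W_V^{(i)}\|_{2,1}\le B_V^{2,1,(i)},\ \|W_C^{(i)}\|_{2,1}\le B_C^{2,1,(i)},$$ where all bounds are nonnegative. For $X^{(1)},\dots,X^{(m)}\in\mathbb R^{T\times d}$ and $\epsilon>0$, let $\mathcal N_\infty(\mathcal F;\epsilon;X^{(1)},\dots,X^{(m)})$ be the least size of a set $\mathcal C\subseteq\mathcal F$ such that every $f\in\mathcal F$ has some $\hat f\in\mathcal C$ with $\max_i|f(X^{(i)})-\hat f(X^{(i)})|\le\epsilon$. Assume $dmT\ge 2$. **Theorem.** The covering numbers below are finite, and the following holds with universal constants. 1. (Layer-wise bound.) There is a universal constant $c>0$ such that, for every $L\ge0$, if all rows of all $X^{(i)}$ have Euclidean norm at most $1$, then $$\log\mathcal N_\infty(\mathcal F;\epsilon;X^{(1)},\dots,X^{(m)})\le c\,\frac{\log(dmT)}{\epsilon^2}\Big(B_w^{2/3}+\sum_{i=1}^L(B_w\alpha_i)^{2/3}\Big[(L_\sigma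 B_C^{2,1,(i)})^{2/3}+(2L_\sigma B_C^{(i)}B_V^{(i)}B_{QK}^{2,1,(i)})^{2/3}+(L_\sigma B_C^{(i)}B_V^{2,1,(i)})^{2/3}\Big]\Big)^3,$$ where $\alpha_i=\prod_{j>i}L_\sigma B_C^{(j)}B_V^{(j)}(1+4B_{QK}^{(j)})$. 2. (Simplified bound.) There is a universal positive integer $c$ such that, if $L\ge1$, all spectral norm bounds are equal to $C_2$, all $(2,1)$-norm bounds are equal to $C_{2,1}$, and all rows of all $X^{(i)}$ have Euclidean norm at most $B_X$, then $$\log\mathcal N_\infty(\mathcal F;\epsilon;X^{(1)},\dots,X^{(m)})\le c\,\big(2\max(1,C_2)\max(1,L_\sigma)\big)^{cL}\cdot\frac{B_X^2\max(1,B_X)^4\,B_w^2\,C_{2,1}^2}{\epsilon^2}\cdot\log(dmT).$$ In particular, for $B_X\le1$ and $C_2,L_\sigma\ge1$ with $C_2L_\sigma\ge2$, the bound is $c\,(C_2L_\sigma)^{2cL}\,B_X^2B_w^2C_{2,1}^2\,\epsilon^{-2}\log(dmT)$. -/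

import Mathlib

open scoped NNReal

noncomputable section

namespace DeepTransformer

/-! ### Covering numbers of function classes on a sample -/

/-- `C` is a (proper) `ε`-cover, in the `ℓ∞` norm over the sample `z`, of the class `F` of functions
with values in a normed space. -/
def IsSampleCover {Z Y : Type*} [NormedAddCommGroup Y] {m : ℕ}
    (F : Set (Z → Y)) (ε : ℝ) (z : Fin m → Z) (C : Set (Z → Y)) : Prop :=
  C ⊆ F ∧ ∀ f ∈ F, ∃ g ∈ C, ∀ i, ‖f (z i) - g (z i)‖ ≤ ε

/-- The `ℓ∞` covering number of the class `F` at scale `ε` on the sample `z`: the least cardinality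
of a cover (`⊤` if there is no finite cover). -/
def sampleCoveringNumber {Z Y : Type*} [NormedAddCommGroup Y] {m : ℕ}
    (F : Set (Z → Y)) (ε : ℝ) (z : Fin m → Z) : ℕ∞ :=
  ⨅ (C : Set (Z → Y)) (_ : IsSampleCover F ε z C), C.encard

/-! ### Norms -/

/-- Euclidean norm of a vector. -/
def vecNorm {n : ℕ} (v : Fin n → ℝ) : ℝ := ‖WithLp.toLp 2 v‖

open scoped Matrix.Norms.L2Operator in
/-- Spectral norm of a matrix (operator norm for the Euclidean norms). -/
def spectralNorm {p q : ℕ} (A : Matrix (Fin p) (Fin q) ℝ) : ℝ := ‖A‖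

/-- The `(2,1)` norm of a matrix: the sum of the Euclidean norms of its columns. -/
def norm21 {p q : ℕ} (A : Matrix (Fin p) (Fin q) ℝ) : ℝ :=
  ∑ j, vecNorm (fun i => A i j)

/-! ### Transformer blocks -/

/-- Euclidean projection of a vector onto the closed unit ball. -/
def projBall {n : ℕ} (v : Fin n → ℝ) : Fin n → ℝ := (max 1 (vecNorm v))⁻¹ • v

/-- Layer normalization: every row is projected onto the closed unit ball. -/
def layerNorm {T n : ℕ} (Z : Matrix (Fin T) (Fin n) ℝ) : Matrix (Fin T) (Fin n) ℝ :=
  Matrix.of fun t => projBall (Z t)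

/-- Softmax of every row. -/
def rowSoftmax {T S : ℕ} (M : Matrix (Fin T) (Fin S) ℝ) : Matrix (Fin T) (Fin S) ℝ :=
  Matrix.of fun t s => Real.exp (M t s) / ∑ u, Real.exp (M t u)

/-- The weight matrices `W_Q, W_K, W_V, W_C` of one layer. -/
structure LayerWeights (d k : ℕ) where
  WQ : Matrix (Fin d) (Fin k) ℝ
  WK : Matrix (Fin d) (Fin k) ℝ
  WV : Matrix (Fin d) (Fin k) ℝ
  WC : Matrix (Fin k) (Fin d) ℝ

/-- Self-attention `RowSoftmax(Z W_Q (Z W_K)ᵀ) Z W_V`. -/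
def attention {d k T : ℕ} (W : LayerWeights d k) (Z : Matrix (Fin T) (Fin d) ℝ) :
    Matrix (Fin T) (Fin k) ℝ :=
  rowSoftmax ((Z * W.WQ) * (Z * W.WK).transpose) * Z * W.WV

/-- One Transformer block `Π_norm(σ(Π_norm(f(Z; W))) W_C)`. -/
def block {d k T : ℕ} (σ : ℝ → ℝ) (W : LayerWeights d k) (Z : Matrix (Fin T) (Fin d) ℝ) :
    Matrix (Fin T) (Fin d) ℝ :=
  layerNorm ((layerNorm (attention W Z)).map σ * W.WC)

/-- The composition of `L` Transformer blocks; block `0` is applied first. -/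
def tfBlock {d k T : ℕ} (σ : ℝ → ℝ) :
    (L : ℕ) → (Fin L → LayerWeights d k) → Matrix (Fin T) (Fin d) ℝ → Matrix (Fin T) (Fin d) ℝ
  | 0, _, X => X
  | L + 1, W, X => block σ (W (Fin.last L)) (tfBlock σ L (fun i => W i.castSucc) X)

/-- Bounds on the norms of the weights of one layer. -/
structure LayerBounds where
  BQK : ℝ
  BV : ℝ
  BC : ℝ
  BQK21 : ℝ
  BV21 : ℝ
  BC21 : ℝ

/-- The weights of a layer obey the spectral norm and `(2,1)` norm bounds `B`. -/
def LayerWeights.Obeys {d k : ℕ} (W : LayerWeights d k) (B : LayerBounds) : Prop :=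
  spectralNorm (W.WK * W.WQ.transpose) ≤ B.BQK ∧ spectralNorm W.WV ≤ B.BV ∧
    spectralNorm W.WC ≤ B.BC ∧
  norm21 (W.WK * W.WQ.transpose) ≤ B.BQK21 ∧ norm21 W.WV ≤ B.BV21 ∧ norm21 W.WC ≤ B.BC21

/-- All the bounds of a layer are nonnegative. -/
def LayerBounds.Nonneg (B : LayerBounds) : Prop :=
  0 ≤ B.BQK ∧ 0 ≤ B.BV ∧ 0 ≤ B.BC ∧ 0 ≤ B.BQK21 ∧ 0 ≤ B.BV21 ∧ 0 ≤ B.BC21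

/-- The same bound `C2` on all spectral norms and `C21` on all `(2,1)` norms. -/
def LayerBounds.uniform (C2 C21 : ℝ) : LayerBounds := ⟨C2, C2, C2, C21, C21, C21⟩

/-- The class of depth-`L` scalar-output Transformers with activation `σ`, layer-wise weight bounds
`B`, and a linear readout `w`, `‖w‖ ≤ Bw`, of the row with index `cls`. -/
def tfScalarClass (d k : ℕ) {T : ℕ} (L : ℕ) (σ : ℝ → ℝ) (B : Fin L → LayerBounds) (Bw : ℝ)
    (cls : Fin T) : Set (Matrix (Fin T) (Fin d) ℝ → ℝ) :=
  {g | ∃ (W : Fin L → LayerWeights d k) (w : Fin d → ℝ),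
      (∀ i, (W i).Obeys (B i)) ∧ vecNorm w ≤ Bw ∧ g = fun X => w ⬝ᵥ tfBlock σ L W X cls}

/-! ### The layer-wise capacity -/

/-- Bound for the Lipschitz constant of one block as a map of its input. -/
def LayerBounds.lip (B : LayerBounds) (Lσ : ℝ) : ℝ := Lσ * B.BC * B.BV * (1 + 4 * B.BQK)

/-- `α i`: the product of the Lipschitz bounds of the blocks that are applied after block `i`. -/
def lipAfter {L : ℕ} (B : Fin L → LayerBounds) (Lσ : ℝ) (i : Fin L) : ℝ :=
  ∏ j ∈ Finset.Ioi i, (B j).lip Lσ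

/-- The layer-wise capacity
`(B_w^{2/3} + ∑ i, (B_w α i)^{2/3} ((Lσ B_C²¹)^{2/3} + (2 Lσ B_C B_V B_QK²¹)^{2/3}
  + (Lσ B_C B_V²¹)^{2/3}))^3`. -/
def layerwiseCapacity {L : ℕ} (B : Fin L → LayerBounds) (Lσ Bw : ℝ) : ℝ :=
  (Bw ^ (2 / 3 : ℝ) + ∑ i, (Bw * lipAfter B Lσ i) ^ (2 / 3 : ℝ) *
    ((Lσ * (B i).BC21) ^ (2 / 3 : ℝ)
      + (2 * Lσ * (B i).BC * (B i).BV * (B i).BQK21) ^ (2 / 3 : ℝ)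
      + (Lσ * (B i).BC * (B i).BV21) ^ (2 / 3 : ℝ))) ^ 3

end DeepTransformer

end

namespace DeepTransformer

/-! ### The Euclidean norm -/

/-! The core is a cover of linear maps `y ↦ yW` with `norm21 W ≤ B` on `N` sample points of norm at
most `R`: accuracy of order `R * B / √(n + 1)` costs only `n` times a logarithm. A single column `v`
is approximated greedily (`exists_decodeVec_close`): while some sample point detects a residual
larger than `δ`, subtract `±δ` times that point. Each subtraction lowers the squared norm by at
least `δ ^ 2`, so a short word in the signed sample points encodes `v` up to `δ` on the sample.
`exists_decodeArray_close` shares a total word length `2 * n` among the columns in proportion to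
their norms.

Recording how the length is shared costs a factor `(q + 1) ^ n` for `q` columns. For `W_V` this
would bring in the inner width `k`, which is absent from the bound. The hidden units can however be
relabelled (`rowHead_submatrix`), so the shares may be taken to be decreasing, and there are at most
`2 ^ n` such profiles.

A block is covered in the order `W_K W_Qᵀ`, `W_V`, `W_C`, each cover being built on the features
produced by the previous choices (`exists_layer_cover`). Projections are nonexpansive and softmax is
`2`-Lipschitz from `ℓ∞` to `ℓ¹`, so blocks are Lipschitz. Composition multiplies the error of a
layer by the Lipschitz constants of the later blocks (`exists_network_cover`).

The total error is then a sum of terms `12 * x / √(n + 1)`, and the logarithmic cost is the sum of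
the `n`. Taking `n` proportional to `x ^ (2 / 3)` gives the cube of the sum of the `x ^ (2 / 3)`.
For uniform bounds, one common `n` together with bounds on the row norms that stay linear in `BX`
suffices. -/

theorem vecNorm_nonneg {n : ℕ} (v : Fin n → ℝ) : 0 ≤ vecNorm v := norm_nonneg _

theorem vecNorm_sq {n : ℕ} (v : Fin n → ℝ) : vecNorm v ^ 2 = ∑ i, v i ^ 2 := by
  simp [vecNorm, EuclideanSpace.norm_sq_eq]

theorem vecNorm_sq_eq_dotProduct {n : ℕ} (v : Fin n → ℝ) : vecNorm v ^ 2 = v ⬝ᵥ v := by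
  rw [vecNorm_sq]
  simp [dotProduct, sq]

theorem vecNorm_zero {n : ℕ} : vecNorm (0 : Fin n → ℝ) = 0 := by simp [vecNorm]

theorem vecNorm_add_le {n : ℕ} (u v : Fin n → ℝ) : vecNorm (u + v) ≤ vecNorm u + vecNorm v := by
  simpa [vecNorm] using norm_add_le (WithLp.toLp 2 u) (WithLp.toLp 2 v)

theorem vecNorm_sub_rev {n : ℕ} (u v : Fin n → ℝ) : vecNorm (u - v) = vecNorm (v - u) := by
  simpa [vecNorm] using norm_sub_rev (WithLp.toLp 2 u) (WithLp.toLp 2 v)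

theorem vecNorm_sub_le_add {n : ℕ} (u v w : Fin n → ℝ) :
    vecNorm (u - w) ≤ vecNorm (u - v) + vecNorm (v - w) := by
  simpa using vecNorm_add_le (u - v) (v - w)

theorem vecNorm_smul {n : ℕ} (a : ℝ) (v : Fin n → ℝ) : vecNorm (a • v) = |a| * vecNorm v := by
  simp [vecNorm, norm_smul]

theorem vecNorm_sum_le {n : ℕ} {ι : Type*} (s : Finset ι) (f : ι → Fin n → ℝ) :
    vecNorm (∑ i ∈ s, f i) ≤ ∑ i ∈ s, vecNorm (f i) := by
  simpa [vecNorm] using norm_sum_le s (fun i => WithLp.toLp 2 (f i))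

theorem abs_dotProduct_le {n : ℕ} (u v : Fin n → ℝ) : |u ⬝ᵥ v| ≤ vecNorm u * vecNorm v := by
  have := abs_real_inner_le_norm (WithLp.toLp 2 v) (WithLp.toLp 2 u)
  rw [EuclideanSpace.inner_toLp_toLp] at this
  simpa [vecNorm, mul_comm] using this

theorem vecNorm_le_of_sq_le {n : ℕ} {v : Fin n → ℝ} {a : ℝ} (ha : 0 ≤ a)
    (h : ∑ i, v i ^ 2 ≤ a ^ 2) : vecNorm v ≤ a :=
  abs_le_of_sq_le_sq' (by rwa [vecNorm_sq]) ha |>.2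

theorem vecNorm_comp_equiv {p q : ℕ} (v : Fin q → ℝ) (π : Fin p ≃ Fin q) :
    vecNorm (v ∘ π) = vecNorm v := by
  rw [← abs_of_nonneg (vecNorm_nonneg v), ← abs_of_nonneg (vecNorm_nonneg (v ∘ π)),
    ← sq_eq_sq_iff_abs_eq_abs, vecNorm_sq, vecNorm_sq]
  exact Equiv.sum_comp π fun i => v i ^ 2

/-! ### Matrix norms -/

theorem vecMul_apply_eq {p q : ℕ} (y : Fin p → ℝ) (W : Matrix (Fin p) (Fin q) ℝ) (j : Fin q) :
    Matrix.vecMul y W j = y ⬝ᵥ fun i => W i j := rfl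

open scoped Matrix.Norms.L2Operator in
theorem vecNorm_vecMul_le_spectralNorm {p q : ℕ} (y : Fin p → ℝ) (W : Matrix (Fin p) (Fin q) ℝ) :
    vecNorm (Matrix.vecMul y W) ≤ spectralNorm W * vecNorm y := by
  have := Matrix.l2_opNorm_mulVec W.conjTranspose (WithLp.toLp 2 y)
  rw [Matrix.l2_opNorm_conjTranspose] at this
  simpa [vecNorm, spectralNorm, Matrix.mulVec_transpose] using this

theorem norm21_nonneg {p q : ℕ} (W : Matrix (Fin p) (Fin q) ℝ) : 0 ≤ norm21 W :=
  Finset.sum_nonneg fun _ _ => vecNorm_nonneg _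

theorem vecNorm_le_sum_abs {n : ℕ} (v : Fin n → ℝ) : vecNorm v ≤ ∑ i, |v i| := by
  apply vecNorm_le_of_sq_le (Finset.sum_nonneg fun _ _ => abs_nonneg _)
  simpa using Finset.sum_sq_le_sq_sum_of_nonneg (s := Finset.univ) (f := fun i => |v i|)
    fun _ _ => abs_nonneg _

theorem vecNorm_vecMul_le_norm21 {p q : ℕ} (y : Fin p → ℝ) (W : Matrix (Fin p) (Fin q) ℝ) :
    vecNorm (Matrix.vecMul y W) ≤ norm21 W * vecNorm y := by
  refine (vecNorm_le_sum_abs _).trans ?_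
  rw [norm21, Finset.sum_mul]
  refine Finset.sum_le_sum fun j _ => ?_
  rw [vecMul_apply_eq, mul_comm]
  exact abs_dotProduct_le _ _

open scoped Matrix.Norms.L2Operator in
theorem spectralNorm_le_of_vecMul {p q : ℕ} {W : Matrix (Fin p) (Fin q) ℝ} {a : ℝ} (ha : 0 ≤ a)
    (h : ∀ y, vecNorm (Matrix.vecMul y W) ≤ a * vecNorm y) : spectralNorm W ≤ a := by
  rw [spectralNorm, ← Matrix.l2_opNorm_conjTranspose, Matrix.l2_opNorm_def]
  refine ContinuousLinearMap.opNorm_le_bound _ ha fun x => ?_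
  have := h (WithLp.ofLp x)
  simpa [vecNorm, Matrix.mulVec_transpose, Matrix.toLpLin_apply] using this

open scoped Matrix.Norms.L2Operator in
theorem spectralNorm_nonneg {p q : ℕ} (W : Matrix (Fin p) (Fin q) ℝ) : 0 ≤ spectralNorm W :=
  norm_nonneg W

theorem spectralNorm_submatrix_col {p q : ℕ} (W : Matrix (Fin p) (Fin q) ℝ)
    (π : Equiv.Perm (Fin q)) : spectralNorm (W.submatrix id π) ≤ spectralNorm W := by
  refine spectralNorm_le_of_vecMul (spectralNorm_nonneg _) fun y => ?_
  have : Matrix.vecMul y (W.submatrix id π) = Matrix.vecMul y W ∘ π := by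
    ext j; simp [vecMul_apply_eq]
  rw [this, vecNorm_comp_equiv]
  exact vecNorm_vecMul_le_spectralNorm y W

theorem vecMul_submatrix_row {p q : ℕ} (W : Matrix (Fin p) (Fin q) ℝ)
    (π : Equiv.Perm (Fin p)) (y : Fin p → ℝ) :
    Matrix.vecMul (y ∘ π) (W.submatrix π id) = Matrix.vecMul y W := by
  ext j
  simp only [vecMul_apply_eq, dotProduct, Matrix.submatrix_apply, Function.comp, id]
  exact Equiv.sum_comp π fun i => y i * W i j

theorem spectralNorm_submatrix_row {p q : ℕ} (W : Matrix (Fin p) (Fin q) ℝ)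
    (π : Equiv.Perm (Fin p)) : spectralNorm (W.submatrix π id) ≤ spectralNorm W := by
  refine spectralNorm_le_of_vecMul (spectralNorm_nonneg _) fun y => ?_
  obtain ⟨z, rfl⟩ : ∃ z, y = z ∘ π := ⟨y ∘ π.symm, by ext; simp⟩
  rw [vecMul_submatrix_row, vecNorm_comp_equiv]
  exact vecNorm_vecMul_le_spectralNorm z W

theorem norm21_submatrix_col {p q : ℕ} (W : Matrix (Fin p) (Fin q) ℝ)
    (π : Equiv.Perm (Fin q)) : norm21 (W.submatrix id π) = norm21 W :=
  Equiv.sum_comp π fun j => vecNorm fun i => W i j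

theorem norm21_submatrix_row {p q : ℕ} (W : Matrix (Fin p) (Fin q) ℝ)
    (π : Equiv.Perm (Fin p)) : norm21 (W.submatrix π id) = norm21 W :=
  Finset.sum_congr rfl fun j _ => vecNorm_comp_equiv (fun i => W i j) π

/-! ### Projections, activations and softmax -/

theorem vecNorm_projBall_le_one {n : ℕ} (v : Fin n → ℝ) : vecNorm (projBall v) ≤ 1 := by
  have h : 0 < max 1 (vecNorm v) := by positivity
  rw [projBall, vecNorm_smul, abs_of_pos (by positivity), inv_mul_le_iff₀ h]
  simp

theorem vecNorm_projBall_le {n : ℕ} (v : Fin n → ℝ) : vecNorm (projBall v) ≤ vecNorm v := by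
  have h : 0 < max 1 (vecNorm v) := by positivity
  rw [projBall, vecNorm_smul, abs_of_pos (by positivity)]
  exact mul_le_of_le_one_left (vecNorm_nonneg v) (inv_le_one_of_one_le₀ (le_max_left _ _))

/-- Variational inequality of the projection: outside the ball, `u - projBall u` is a nonnegative
multiple of `u`, and Cauchy–Schwarz bounds `u ⬝ᵥ w` by `vecNorm u`. -/
theorem sub_projBall_dotProduct_nonpos {n : ℕ} (u w : Fin n → ℝ) (hw : vecNorm w ≤ 1) :
    (u - projBall u) ⬝ᵥ (w - projBall u) ≤ 0 := by
  have hu := vecNorm_nonneg u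
  rcases le_total (vecNorm u) 1 with h | h
  · simp [projBall, max_eq_left h]
  have hpos : 0 < vecNorm u := by linarith
  have h1 : u - projBall u = (1 - (vecNorm u)⁻¹) • u := by
    simp [projBall, max_eq_right h, sub_smul]
  have h2 : (u - projBall u) ⬝ᵥ (w - projBall u)
      = (1 - (vecNorm u)⁻¹) * (u ⬝ᵥ w - vecNorm u) := by
    rw [h1, projBall, max_eq_right h, smul_dotProduct, dotProduct_sub, dotProduct_smul,
      ← vecNorm_sq_eq_dotProduct]
    simp only [smul_eq_mul]
    field_simp
  rw [h2]
  refine mul_nonpos_of_nonneg_of_nonpos (by simpa using inv_le_one_of_one_le₀ h) ?_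
  have := (le_abs_self _).trans (abs_dotProduct_le u w)
  nlinarith

/-- Adding the variational inequalities at `u` and at `v` gives firm nonexpansiveness (`h3`);
Cauchy–Schwarz does the rest. -/
theorem vecNorm_projBall_sub_le {n : ℕ} (u v : Fin n → ℝ) :
    vecNorm (projBall u - projBall v) ≤ vecNorm (u - v) := by
  have h1 := sub_projBall_dotProduct_nonpos u (projBall v) (vecNorm_projBall_le_one v)
  have h2 := sub_projBall_dotProduct_nonpos v (projBall u) (vecNorm_projBall_le_one u)
  have h3 : vecNorm (projBall u - projBall v) ^ 2 ≤ (u - v) ⬝ᵥ (projBall u - projBall v) := by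
    rw [vecNorm_sq_eq_dotProduct]
    simp only [sub_dotProduct, dotProduct_sub] at *
    linarith
  have h4 := h3.trans ((le_abs_self _).trans (abs_dotProduct_le _ _))
  by_contra! hlt
  have := vecNorm_nonneg (u - v)
  nlinarith

theorem vecNorm_comp_sub_le {n : ℕ} {σ : ℝ → ℝ} {Lσ : ℝ≥0} (hσ : LipschitzWith Lσ σ)
    (u v : Fin n → ℝ) : vecNorm (σ ∘ u - σ ∘ v) ≤ Lσ * vecNorm (u - v) := by
  apply vecNorm_le_of_sq_le (mul_nonneg Lσ.2 (vecNorm_nonneg _))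
  rw [mul_pow, vecNorm_sq, Finset.mul_sum]
  refine Finset.sum_le_sum fun i _ => ?_
  rw [← mul_pow, sq_le_sq, abs_mul]
  simpa [Real.dist_eq] using hσ.dist_le_mul (u i) (v i)

theorem vecNorm_comp_le {n : ℕ} {σ : ℝ → ℝ} {Lσ : ℝ≥0} (hσ : LipschitzWith Lσ σ) (h0 : σ 0 = 0)
    (u : Fin n → ℝ) : vecNorm (σ ∘ u) ≤ Lσ * vecNorm u := by
  have h : σ ∘ (0 : Fin n → ℝ) = 0 := by ext; simp [h0]
  simpa [h] using vecNorm_comp_sub_le hσ u 0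

/-- The softmax of a vector. -/
noncomputable def softmaxVec {n : ℕ} (u : Fin n → ℝ) : Fin n → ℝ :=
  fun i => Real.exp (u i) / ∑ j, Real.exp (u j)

theorem softmaxVec_nonneg {n : ℕ} (u : Fin n → ℝ) (i : Fin n) : 0 ≤ softmaxVec u i := by
  unfold softmaxVec; positivity

theorem sum_softmaxVec {n : ℕ} [NeZero n] (u : Fin n → ℝ) : ∑ i, softmaxVec u i = 1 := by
  unfold softmaxVec
  rw [← Finset.sum_div, div_self]
  exact (Finset.sum_pos (fun i _ => Real.exp_pos _) Finset.univ_nonempty).ne'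

theorem sum_softmaxVec_le {n : ℕ} (u : Fin n → ℝ) : ∑ i, softmaxVec u i ≤ 1 := by
  rcases n with _ | n
  · simp
  · exact (sum_softmaxVec u).le

theorem hasDerivAt_softmaxVec {n : ℕ} [NeZero n] (u w : Fin n → ℝ) (i : Fin n) (s : ℝ) :
    HasDerivAt (fun s => softmaxVec (u + s • w) i)
      (softmaxVec (u + s • w) i * (w i - ∑ j, softmaxVec (u + s • w) j * w j)) s := by
  have hpos : (0 : ℝ) < ∑ j, Real.exp ((u + s • w) j) :=
    Finset.sum_pos (fun i _ => Real.exp_pos _) Finset.univ_nonempty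
  have he : ∀ j, HasDerivAt (fun s : ℝ => Real.exp ((u + s • w) j))
      (Real.exp ((u + s • w) j) * w j) s := fun j => by
    have : HasDerivAt (fun s : ℝ => (u + s • w) j) (w j) s := by
      simpa using ((hasDerivAt_id s).mul_const (w j)).const_add (u j)
    exact this.exp
  have hs := HasDerivAt.fun_sum (u := Finset.univ) fun j _ => he j
  have := (he i).fun_div hs hpos.ne'
  refine this.congr_deriv ?_
  unfold softmaxVec
  simp only [div_mul_eq_mul_div, ← Finset.sum_div]
  field_simp

/-- With the signs `ρ` of the differences fixed, the `ℓ¹` distance is the increment of a scalar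
function along the segment from `v` to `u`. Its derivative is a signed average, under the softmax
weights, of the deviations of `w` from its own mean, each at most `2 * δ`. -/
theorem sum_abs_softmaxVec_sub_le {n : ℕ} (u v : Fin n → ℝ) {δ : ℝ} (hδ : 0 ≤ δ)
    (h : ∀ i, |u i - v i| ≤ δ) : ∑ i, |softmaxVec u i - softmaxVec v i| ≤ 2 * δ := by
  rcases n with _ | n
  · simpa using hδ
  set w := u - v with hw
  have hwδ : ∀ i, |w i| ≤ δ := fun i => h i
  let ρ : Fin (n + 1) → ℝ := fun i => SignType.sign (softmaxVec u i - softmaxVec v i)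
  have hρ : ∀ i, |ρ i| ≤ 1 := fun i => by
    simp only [ρ]
    rcases lt_trichotomy (softmaxVec u i - softmaxVec v i) 0 with hi | hi | hi <;> simp [hi]
  have hder : ∀ s : ℝ, HasDerivAt (fun s : ℝ => ∑ i, ρ i * softmaxVec (v + s • w) i)
      (∑ i, ρ i * (softmaxVec (v + s • w) i *
        (w i - ∑ j, softmaxVec (v + s • w) j * w j))) s := fun s =>
    HasDerivAt.fun_sum fun i _ => (hasDerivAt_softmaxVec v w i s).const_mul (ρ i)
  have key := norm_image_sub_le_of_norm_deriv_le_segment_01' (C := 2 * δ)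
    (fun s _ => (hder s).hasDerivWithinAt) fun s _ => by
      set p := softmaxVec (v + s • w)
      have hp := softmaxVec_nonneg (v + s • w)
      have hp1 : ∑ i, p i = 1 := sum_softmaxVec (v + s • w)
      have hmean : |∑ j, p j * w j| ≤ δ := by
        refine (Finset.abs_sum_le_sum_abs _ _).trans ?_
        calc ∑ j, |p j * w j| ≤ ∑ j, p j * δ := Finset.sum_le_sum fun j _ => by
              rw [abs_mul, abs_of_nonneg (hp j)]
              exact mul_le_mul_of_nonneg_left (hwδ j) (hp j)
          _ = δ := by rw [← Finset.sum_mul, hp1, one_mul]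
      rw [Real.norm_eq_abs]
      refine (Finset.abs_sum_le_sum_abs _ _).trans ?_
      calc ∑ i, |ρ i * (p i * (w i - ∑ j, p j * w j))| ≤ ∑ i, p i * (2 * δ) :=
            Finset.sum_le_sum fun i _ => by
              rw [abs_mul, abs_mul, abs_of_nonneg (hp i)]
              refine (mul_le_of_le_one_left (mul_nonneg (hp i) (abs_nonneg _)) (hρ i)).trans ?_
              refine mul_le_mul_of_nonneg_left ?_ (hp i)
              exact (abs_sub _ _).trans (by linarith [hwδ i])
        _ = 2 * δ := by rw [← Finset.sum_mul, hp1, one_mul]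
  have hend : v + w = u := by simp [hw]
  simp only [one_smul, zero_smul, add_zero, hend, ← Finset.sum_sub_distrib, ← mul_sub] at key
  refine le_trans (le_of_eq ?_) ((le_abs_self _).trans key)
  exact Finset.sum_congr rfl fun i _ => (sign_mul_self _).symm

/-! ### Covers of linear maps with bounded `(2,1)` norm -/

/-- The vector encoded by a sequence of signed sample points. -/
def decodeVec {ι : Type*} {p : ℕ} (y : ι → Fin p → ℝ) (δ : ℝ) {s : ℕ}
    (a : Fin s → Option (ι × Bool)) : Fin p → ℝ :=
  ∑ l, (a l).elim 0 fun x => (bif x.2 then δ else -δ) • y x.1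

theorem decodeVec_cons {ι : Type*} {p : ℕ} (y : ι → Fin p → ℝ) (δ : ℝ) {s : ℕ}
    (o : Option (ι × Bool)) (a : Fin s → Option (ι × Bool)) :
    decodeVec y δ (Fin.cons o a : Fin (s + 1) → _)
      = (o.elim 0 fun x => (bif x.2 then δ else -δ) • y x.1) + decodeVec y δ a := by
  simp [decodeVec, Fin.sum_univ_succ]

/-- Greedy approximation with a perceptron-type step count: the squared norm pays `δ ^ 2` for each
correction, so it is exhausted after `s` of them. The letter `none` pads words that stop early. -/
theorem exists_decodeVec_close {ι : Type*} {p : ℕ} {y : ι → Fin p → ℝ}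
    (hy : ∀ i, vecNorm (y i) ≤ 1) {δ : ℝ} (hδ : 0 ≤ δ) (s : ℕ) (v : Fin p → ℝ)
    (hv : vecNorm v ^ 2 ≤ s * δ ^ 2) :
    ∃ a : Fin s → Option (ι × Bool), ∀ i, |y i ⬝ᵥ (v - decodeVec y δ a)| ≤ δ := by
  induction s generalizing v with
  | zero =>
    refine ⟨Fin.elim0, fun i => (abs_dotProduct_le _ _).trans ?_⟩
    have : vecNorm v = 0 := by
      have := vecNorm_nonneg v
      simp only [Nat.cast_zero, zero_mul] at hv
      nlinarith
    simpa [decodeVec, this] using hδ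
  | succ s ih =>
    by_cases h : ∀ i, |y i ⬝ᵥ v| ≤ δ
    · refine ⟨fun _ => none, fun i => ?_⟩
      simpa [decodeVec] using h i
    push Not at h
    obtain ⟨i, hi⟩ := h
    -- Expanding the square, the cross term gains at least `2 * δ ^ 2` and the quadratic term loses
    -- at most `δ ^ 2`.
    have step : ∀ η : ℝ, η ^ 2 = δ ^ 2 → δ ^ 2 ≤ η * (y i ⬝ᵥ v) →
        vecNorm (v - η • y i) ^ 2 ≤ s * δ ^ 2 := fun η h1 h2 => by
      have e : vecNorm (v - η • y i) ^ 2
          = vecNorm v ^ 2 - 2 * (η * (y i ⬝ᵥ v)) + η ^ 2 * vecNorm (y i) ^ 2 := by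
        simp only [vecNorm_sq_eq_dotProduct, sub_dotProduct, dotProduct_sub, smul_dotProduct,
          dotProduct_smul, smul_eq_mul, dotProduct_comm v (y i)]
        ring
      have h3 : vecNorm (y i) ^ 2 ≤ 1 := pow_le_one₀ (vecNorm_nonneg _) (hy i)
      have h4 : η ^ 2 * vecNorm (y i) ^ 2 ≤ δ ^ 2 := by
        rw [h1]; exact mul_le_of_le_one_right (sq_nonneg _) h3
      push_cast at hv
      rw [e]; linarith
    have fin : ∀ b : Bool, vecNorm (v - (bif b then δ else -δ) • y i) ^ 2 ≤ s * δ ^ 2 →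
        ∃ a : Fin (s + 1) → Option (ι × Bool), ∀ i, |y i ⬝ᵥ (v - decodeVec y δ a)| ≤ δ := by
      intro b hb
      obtain ⟨a, ha⟩ := ih _ hb
      refine ⟨Fin.cons (some (i, b)) a, fun l => ?_⟩
      rw [decodeVec_cons]
      simpa [sub_sub] using ha l
    rcases le_total 0 (y i ⬝ᵥ v) with h0 | h0
    · rw [abs_of_nonneg h0] at hi
      exact fin true (step _ rfl (by simp only [cond_true]; nlinarith))
    · rw [abs_of_nonpos h0] at hi
      exact fin false (step _ (by simp) (by simp only [cond_false]; nlinarith))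

/-- The integer profile of the column norms of a matrix, at resolution `B / n`. -/
noncomputable def columnProfile {p q : ℕ} (n : ℕ) (B : ℝ) (W : Matrix (Fin p) (Fin q) ℝ) :
    Fin q → ℕ :=
  fun j => ⌊n * vecNorm (fun i => W i j) / B⌋₊

theorem sum_columnProfile_le {p q n : ℕ} {B : ℝ} {W : Matrix (Fin p) (Fin q) ℝ}
    (hW : norm21 W ≤ B) : ∑ j, columnProfile n B W j ≤ n := by
  have hB := (norm21_nonneg W).trans hW
  have h : ∀ j, (columnProfile n B W j : ℝ) ≤ n * vecNorm (fun i => W i j) / B := fun j =>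
    Nat.floor_le (div_nonneg (mul_nonneg n.cast_nonneg (vecNorm_nonneg _)) hB)
  have : ((∑ j, columnProfile n B W j : ℕ) : ℝ) ≤ n := by
    push_cast
    refine (Finset.sum_le_sum fun j _ => h j).trans ?_
    rw [← Finset.sum_div, ← Finset.mul_sum]
    exact div_le_of_le_mul₀ hB n.cast_nonneg (mul_le_mul_of_nonneg_left hW n.cast_nonneg)
  exact_mod_cast this

theorem vecNorm_col_le_norm21 {p q : ℕ} (W : Matrix (Fin p) (Fin q) ℝ) (j : Fin q) :
    vecNorm (fun i => W i j) ≤ norm21 W :=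
  Finset.single_le_sum (f := fun j => vecNorm fun i => W i j) (fun _ _ => vecNorm_nonneg _)
    (Finset.mem_univ j)

theorem vecNorm_col_le_columnProfile {p q n : ℕ} (hn : 0 < n) {B : ℝ}
    {W : Matrix (Fin p) (Fin q) ℝ} (hW : norm21 W ≤ B) (j : Fin q) :
    vecNorm (fun i => W i j) ≤ B * (columnProfile n B W j + 1) / n := by
  have hn' : (0 : ℝ) < n := by exact_mod_cast hn
  have hj := (vecNorm_col_le_norm21 W j).trans hW
  rcases ((vecNorm_nonneg _).trans hj).eq_or_lt with hB | hB
  · rw [← hB] at hj ⊢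
    simpa using hj
  · have := (Nat.lt_floor_add_one (n * vecNorm (fun i => W i j) / B)).le
    rw [div_le_iff₀ hB] at this
    rw [le_div_iff₀ hn', mul_comm, mul_comm B]
    exact this

/-- The array of linear functionals encoded by signed point sequences, one for each column. -/
noncomputable def decodeArray {ι : Type*} {p q : ℕ} (y : ι → Fin p → ℝ) (n : ℕ) (B : ℝ)
    (ν : Fin q → ℕ) (a : ∀ j, Fin (2 * ν j) → Option (ι × Bool)) : ι → Fin q → ℝ :=
  fun i j => y i ⬝ᵥ decodeVec y (B * √(2 * ν j) / n) (a j)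

/-- The tolerance in column `j` is chosen so that `2 * ν j` greedy steps suffice. Since the squared
tolerances are linear in `ν j` and the profile sums to at most `n`, the total squared error does not
depend on the number of columns. -/
theorem exists_decodeArray_close {ι : Type*} {p q n : ℕ} (hn : 0 < n) {y : ι → Fin p → ℝ}
    (hy : ∀ i, vecNorm (y i) ≤ 1) {B : ℝ} {W : Matrix (Fin p) (Fin q) ℝ} (hW : norm21 W ≤ B) :
    ∃ a, ∀ i, vecNorm (Matrix.vecMul (y i) W - decodeArray y n B (columnProfile n B W) a i)
      ≤ 3 * B / √(n + 1) := by
  have hn' : (0 : ℝ) < n := by exact_mod_cast hn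
  have hB := (norm21_nonneg W).trans hW
  set ν := columnProfile n B W with hν
  set b : Fin q → ℝ := fun j => vecNorm fun i => W i j with hb
  have hb0 : ∀ j, 0 ≤ b j := fun j => vecNorm_nonneg _
  have hbν : ∀ j, b j ≤ B * (ν j + 1) / n := vecNorm_col_le_columnProfile hn hW
  have hδ : ∀ j, 0 ≤ B * √(2 * ν j) / n := fun j => by positivity
  have hδ2 : ∀ j, (B * √(2 * ν j) / n) ^ 2 = B ^ 2 * (2 * ν j) / n ^ 2 := fun j => by
    rw [div_pow, mul_pow, Real.sq_sqrt (by positivity)]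
  have hex : ∀ j, ∃ a : Fin (2 * ν j) → Option (ι × Bool), ∀ i,
      (y i ⬝ᵥ ((fun i => W i j) - decodeVec y (B * √(2 * ν j) / n) a)) ^ 2
        ≤ B ^ 2 * (2 * ν j) / n ^ 2 + b j * B / n := fun j => by
    -- A column with zero profile has norm at most `B / n` and is replaced by `0`. Its squared error
    -- is kept as `b j * B / n`, which sums over all columns to at most `B ^ 2 / n`.
    rcases (ν j).eq_zero_or_pos with h0 | h0
    · refine ⟨fun _ => none, fun i => ?_⟩
      have h1 : |y i ⬝ᵥ fun i => W i j| ≤ b j :=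
        (abs_dotProduct_le _ _).trans (mul_le_of_le_one_left (hb0 j) (hy i))
      have h2 : b j ≤ B / n := by simpa [h0] using hbν j
      have h3 : (y i ⬝ᵥ fun i => W i j) ^ 2 ≤ b j ^ 2 := sq_le_sq' (abs_le.1 h1).1 (abs_le.1 h1).2
      have h4 : b j ^ 2 ≤ b j * B / n := by
        rw [sq, mul_div_assoc]; exact mul_le_mul_of_nonneg_left h2 (hb0 j)
      simpa [decodeVec, h0] using h3.trans h4
    -- Here `ν j + 1 ≤ 2 * ν j`, hence `b j ^ 2 ≤ (2 * B * ν j / n) ^ 2`, which is exactly `2 * ν j`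
    -- times the squared tolerance.
    · have h1 : (1 : ℝ) ≤ ν j := by exact_mod_cast h0
      obtain ⟨a, ha⟩ := exists_decodeVec_close hy (hδ j) (2 * ν j) (fun i => W i j) (by
        rw [hδ2]
        have h2 : b j ≤ B * (2 * ν j) / n := (hbν j).trans (by gcongr; linarith)
        refine (pow_le_pow_left₀ (hb0 j) h2 2).trans (le_of_eq ?_)
        push_cast
        ring)
      refine ⟨a, fun i => ?_⟩
      have h2 := sq_le_sq' (abs_le.1 (ha i)).1 (abs_le.1 (ha i)).2
      rw [hδ2] at h2
      exact h2.trans (le_add_of_nonneg_right (by have := hb0 j; positivity))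
  choose a ha using hex
  refine ⟨a, fun i => vecNorm_le_of_sq_le (by positivity) ?_⟩
  have hν' : ∑ j, (ν j : ℝ) ≤ n := by exact_mod_cast sum_columnProfile_le hW
  have hbB : ∑ j, b j ≤ B := hW
  calc ∑ j, (Matrix.vecMul (y i) W - decodeArray y n B ν a i) j ^ 2
      ≤ ∑ j, (B ^ 2 * (2 * ν j) / n ^ 2 + b j * B / n) := by
        refine Finset.sum_le_sum fun j _ => le_of_eq_of_le ?_ (ha j i)
        rw [Pi.sub_apply, vecMul_apply_eq, decodeArray, dotProduct_sub]
    _ = 2 * B ^ 2 / n ^ 2 * ∑ j, (ν j : ℝ) + B / n * ∑ j, b j := by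
        rw [Finset.sum_add_distrib, Finset.mul_sum, Finset.mul_sum]
        congr 1 <;> exact Finset.sum_congr rfl fun j _ => by ring
    _ ≤ 2 * B ^ 2 / n ^ 2 * n + B / n * B := by gcongr
    _ = 3 * B ^ 2 / n := by field_simp; ring
    _ ≤ (3 * B / √(n + 1)) ^ 2 := by
        rw [div_pow, Real.sq_sqrt (by positivity), div_le_div_iff₀ hn' (by positivity)]
        have : (1 : ℝ) ≤ n := by exact_mod_cast hn
        nlinarith [mul_nonneg (sq_nonneg B) (sub_nonneg.2 this), sq_nonneg B]

/-- For a fixed profile of sum at most `n`, the words in all columns have total length at most `2 *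
n` over an alphabet of `2 * N + 1` letters, with `N` sample points. Leaving the set `P` of profiles
open lets the same encoding serve for all profiles and for decreasing ones. -/
theorem exists_cover_of_columnProfile_mem {ι : Type*} [Fintype ι] {p q : ℕ} (n : ℕ)
    (P : Finset (Fin q → ℕ)) (hP : P.Nonempty) {y : ι → Fin p → ℝ} {R : ℝ} (hR : 0 ≤ R)
    (hy : ∀ i, vecNorm (y i) ≤ R) (B : ℝ) :
    ∃ S : Finset (ι → Fin q → ℝ), S.card ≤ P.card * (2 * Fintype.card ι + 1) ^ (2 * n) ∧
      ∀ W : Matrix (Fin p) (Fin q) ℝ, norm21 W ≤ B → columnProfile n B W ∈ P →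
        ∃ A ∈ S, ∀ i, vecNorm (Matrix.vecMul (y i) W - A i) ≤ R * (3 * B / √(n + 1)) := by
  classical
  have hcard : 1 ≤ P.card * (2 * Fintype.card ι + 1) ^ (2 * n) :=
    Nat.one_le_iff_ne_zero.2 (mul_ne_zero hP.card_pos.ne' (by positivity))
  -- In the degenerate cases the zero array is a cover: at `n = 0` the permitted error `3 * R * B`
  -- exceeds the trivial bound `R * B`.
  have hzero : R = 0 ∨ n = 0 → ∀ W : Matrix (Fin p) (Fin q) ℝ, norm21 W ≤ B →
      ∀ i, vecNorm (Matrix.vecMul (y i) W) ≤ R * (3 * B / √(n + 1)) := fun h W hW i => by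
    have hB := (norm21_nonneg W).trans hW
    refine (vecNorm_vecMul_le_norm21 _ _).trans ?_
    refine (mul_le_mul hW (hy i) (vecNorm_nonneg _) hB).trans ?_
    rcases h with rfl | rfl
    · simp
    · have := mul_nonneg hB hR
      simp; linarith
  rcases hR.eq_or_lt with hR0 | hR0
  · exact ⟨{0}, by simpa using hcard, fun W hW _ => ⟨0, by simp, fun i => by
      simpa using hzero (.inl hR0.symm) W hW i⟩⟩
  rcases n.eq_zero_or_pos with hn | hn
  · exact ⟨{0}, by simpa using hcard, fun W hW _ => ⟨0, by simp, fun i => by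
      simpa using hzero (.inr hn) W hW i⟩⟩
  set y' : ι → Fin p → ℝ := fun i => R⁻¹ • y i with hy'
  have hy1 : ∀ i, vecNorm (y' i) ≤ 1 := fun i => by
    rw [hy', vecNorm_smul, abs_of_pos (by positivity), inv_mul_le_iff₀ hR0, mul_one]
    exact hy i
  refine ⟨(P.filter fun ν => ∑ j, ν j ≤ n).biUnion fun ν =>
    Finset.univ.image fun a => R • decodeArray y' n B ν a, ?_, fun W hW hWP => ?_⟩
  · refine (Finset.card_biUnion_le_card_mul _ _ ((2 * Fintype.card ι + 1) ^ (2 * n))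
      fun ν hν => ?_).trans (Nat.mul_le_mul_right _ (Finset.card_filter_le _ _))
    refine Finset.card_image_le.trans ?_
    rw [Finset.card_univ, Fintype.card_pi]
    simp only [Fintype.card_fun, Fintype.card_option, Fintype.card_prod, Fintype.card_bool,
      Fintype.card_fin]
    rw [Finset.prod_pow_eq_pow_sum, ← Finset.mul_sum, mul_comm (Fintype.card ι)]
    exact Nat.pow_le_pow_right (by omega) (Nat.mul_le_mul_left 2 (Finset.mem_filter.1 hν).2)
  · obtain ⟨a, ha⟩ := exists_decodeArray_close hn hy1 hW
    refine ⟨R • decodeArray y' n B (columnProfile n B W) a, Finset.mem_biUnion.2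
      ⟨_, Finset.mem_filter.2 ⟨hWP, sum_columnProfile_le hW⟩, Finset.mem_image_of_mem _
        (Finset.mem_univ a)⟩, fun i => ?_⟩
    have h1 : y i = R • y' i := by rw [hy', smul_smul, mul_inv_cancel₀ hR0.ne', one_smul]
    rw [h1, Matrix.smul_vecMul, Pi.smul_apply, ← smul_sub, vecNorm_smul, abs_of_pos hR0]
    exact mul_le_mul_of_nonneg_left (ha i) hR

/-! ### Counting profiles -/

/-- A profile is built in `n` moves, each raising one of the `q` coordinates or doing nothing. -/
theorem exists_finset_sum_le (q n : ℕ) : ∃ P : Finset (Fin q → ℕ), P.Nonempty ∧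
    P.card ≤ (q + 1) ^ n ∧ ∀ ν : Fin q → ℕ, ∑ j, ν j ≤ n → ν ∈ P := by
  classical
  induction n with
  | zero => exact ⟨{0}, by simp, by simp, fun ν hν => by
      simpa [funext_iff] using hν⟩
  | succ n ih =>
    obtain ⟨P, hne, hP, h⟩ := ih
    refine ⟨(P ×ˢ (Finset.univ : Finset (Option (Fin q)))).image fun x =>
      x.1 + x.2.elim 0 fun j => Pi.single j 1, ?_, ?_, fun ν hν => ?_⟩
    · exact (hne.product Finset.univ_nonempty).image _
    · refine Finset.card_image_le.trans ?_
      rw [Finset.card_product, pow_succ]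
      simpa using Nat.mul_le_mul_right (q + 1) hP
    · by_cases h0 : ∑ j, ν j ≤ n
      · exact Finset.mem_image.2 ⟨(ν, none), by simp [h ν h0], by simp⟩
      · obtain ⟨j, -, hj⟩ : ∃ j ∈ Finset.univ, ν j ≠ 0 := Finset.exists_ne_zero_of_sum_ne_zero
          (by omega)
        have e : ν - Pi.single j 1 + Pi.single j 1 = ν := by
          refine tsub_add_cancel_of_le fun i => ?_
          rcases eq_or_ne i j with rfl | hij
          · simpa using Nat.one_le_iff_ne_zero.2 hj
          · simp [hij]
        refine Finset.mem_image.2 ⟨(ν - Pi.single j 1, some j), ?_, e⟩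
        refine Finset.mem_product.2 ⟨h _ ?_, Finset.mem_univ _⟩
        have : ∑ i, (ν - Pi.single j 1 : Fin q → ℕ) i + ∑ i, (Pi.single j 1 : Fin q → ℕ) i = ∑ i, ν i := by
          rw [← Finset.sum_add_distrib]
          exact Finset.sum_congr rfl fun i _ => congrFun e i
        rw [Finset.sum_pi_single'] at this
        simp only [Finset.mem_univ, if_true] at this
        change ∑ i, (ν - Pi.single j 1 : Fin q → ℕ) i ≤ n
        omega

/-- Remove the first entry and let `b < n` be the sum left for the others. A decreasing profile with
first entry `0` vanishes, so the count is at most `1 + ∑ b < n, 2 ^ b = 2 ^ n`. -/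
theorem exists_finset_antitone_sum_le (q n : ℕ) : ∃ P : Finset (Fin q → ℕ), P.Nonempty ∧
    P.card ≤ 2 ^ n ∧ ∀ ν : Fin q → ℕ, Antitone ν → ∑ j, ν j ≤ n → ν ∈ P := by
  classical
  induction q generalizing n with
  | zero => exact ⟨{0}, by simp, by simpa using Nat.one_le_two_pow, fun ν _ _ => by
      simpa using Subsingleton.elim _ _⟩
  | succ q ih =>
    choose P _ hP h using ih
    refine ⟨{0} ∪ (Finset.range n).biUnion fun b => (P b).image fun ν =>
      (Fin.cons (n - b) ν : Fin (q + 1) → ℕ), by simp, ?_, fun ν hν hs => ?_⟩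
    · have h1 : ((Finset.range n).biUnion fun b => (P b).image fun ν =>
          (Fin.cons (n - b) ν : Fin (q + 1) → ℕ)).card ≤ ∑ b ∈ Finset.range n, 2 ^ b :=
        Finset.card_biUnion_le.trans (Finset.sum_le_sum fun b _ =>
          Finset.card_image_le.trans (hP b))
      rw [Nat.geomSum_eq le_rfl] at h1
      have h2 := Finset.card_union_le {(0 : Fin (q + 1) → ℕ)} ((Finset.range n).biUnion fun b =>
        (P b).image fun ν => (Fin.cons (n - b) ν : Fin (q + 1) → ℕ))
      have := Nat.one_le_two_pow (n := n)
      simp only [Finset.card_singleton] at h2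
      omega
    · rw [Finset.mem_union, Finset.mem_singleton]
      rcases (ν 0).eq_zero_or_pos with h0 | h0
      · left
        ext i
        simpa [h0] using hν (Fin.zero_le i)
      · right
        rw [Fin.sum_univ_succ] at hs
        refine Finset.mem_biUnion.2 ⟨n - ν 0, by simp; omega, Finset.mem_image.2
          ⟨Fin.tail ν, h _ _ (fun i j hij => hν (Fin.succ_le_succ_iff.2 hij)) ?_, ?_⟩⟩
        · simp only [Fin.tail]; omega
        · rw [show n - (n - ν 0) = ν 0 by omega, Fin.cons_self_tail]

theorem exists_perm_antitone {q : ℕ} (ν : Fin q → ℕ) : ∃ π : Equiv.Perm (Fin q),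
    Antitone (ν ∘ π) :=
  ⟨(Fin.revPerm).trans (Tuple.sort ν), fun _ _ hij =>
    Tuple.monotone_sort ν (Fin.rev_le_rev.2 hij)⟩

/-! ### Covers of matrix classes -/

theorem exists_cover_norm21 {ι : Type*} [Fintype ι] {p : ℕ} (q n : ℕ) {y : ι → Fin p → ℝ} {R : ℝ}
    (hR : 0 ≤ R) (hy : ∀ i, vecNorm (y i) ≤ R) (B : ℝ) :
    ∃ S : Finset (ι → Fin q → ℝ), S.card ≤ ((q + 1) * (2 * Fintype.card ι + 1) ^ 2) ^ n ∧
      ∀ W : Matrix (Fin p) (Fin q) ℝ, norm21 W ≤ B →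
        ∃ A ∈ S, ∀ i, vecNorm (Matrix.vecMul (y i) W - A i) ≤ R * (3 * B / √(n + 1)) := by
  obtain ⟨P, hne, hP, h⟩ := exists_finset_sum_le q n
  obtain ⟨S, hS, hS'⟩ := exists_cover_of_columnProfile_mem n P hne hR hy B
  refine ⟨S, hS.trans ?_, fun W hW => hS' W hW (h _ (sum_columnProfile_le hW))⟩
  rw [mul_pow, ← pow_mul]
  exact Nat.mul_le_mul_right _ hP

/-- Sorting the columns by their profile removes `q` from the cardinality. -/
theorem exists_cover_norm21_perm {ι : Type*} [Fintype ι] {p : ℕ} (q n : ℕ) {y : ι → Fin p → ℝ}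
    {R : ℝ} (hR : 0 ≤ R) (hy : ∀ i, vecNorm (y i) ≤ R) (B : ℝ) :
    ∃ S : Finset (ι → Fin q → ℝ), S.card ≤ (2 * (2 * Fintype.card ι + 1) ^ 2) ^ n ∧
      ∀ W : Matrix (Fin p) (Fin q) ℝ, norm21 W ≤ B → ∃ π : Equiv.Perm (Fin q),
        ∃ A ∈ S, ∀ i, vecNorm (Matrix.vecMul (y i) (W.submatrix id π) - A i)
          ≤ R * (3 * B / √(n + 1)) := by
  obtain ⟨P, hne, hP, h⟩ := exists_finset_antitone_sum_le q n
  obtain ⟨S, hS, hS'⟩ := exists_cover_of_columnProfile_mem n P hne hR hy B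
  refine ⟨S, hS.trans ?_, fun W hW => ?_⟩
  · rw [mul_pow, ← pow_mul]
    exact Nat.mul_le_mul_right _ hP
  · obtain ⟨π, hπ⟩ := exists_perm_antitone (columnProfile n B W)
    have hW' : norm21 (W.submatrix id π) ≤ B := by rwa [norm21_submatrix_col]
    exact ⟨π, hS' _ hW' (h _ hπ (sum_columnProfile_le hW'))⟩

/-- A finite cover can be replaced by one that consists of members of the class. -/
theorem exists_proper_cover {A E : Type*} (P : A → Prop) (close : A → E → Prop) (S : Finset E)
    (h : ∀ a, P a → ∃ s ∈ S, close a s) :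
    ∃ S' : Finset A, S'.card ≤ S.card ∧ (∀ a ∈ S', P a) ∧
      ∀ a, P a → ∃ a' ∈ S', ∃ s, close a s ∧ close a' s := by
  classical
  let S₀ := S.filter fun s => ∃ a, P a ∧ close a s
  have hex : ∀ s : S₀, ∃ a, P a ∧ close a s := fun s => (Finset.mem_filter.1 s.2).2
  choose r hr using hex
  refine ⟨S₀.attach.image r, ?_, fun a ha => ?_, fun a ha => ?_⟩
  · exact Finset.card_image_le.trans ((Finset.card_attach).trans_le (Finset.card_filter_le _ _))
  · obtain ⟨s, -, rfl⟩ := Finset.mem_image.1 ha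
    exact (hr s).1
  · obtain ⟨s, hs, hc⟩ := h a ha
    have hs' : s ∈ S₀ := Finset.mem_filter.2 ⟨hs, a, ha, hc⟩
    exact ⟨r ⟨s, hs'⟩, Finset.mem_image_of_mem _ (Finset.mem_attach _ _), s, hc, (hr _).2⟩

/-- A cover, up to a permutation of the columns, by matrices of the class. -/
theorem exists_proper_cover_perm {ι : Type*} [Fintype ι] {p : ℕ} (q n : ℕ) {y : ι → Fin p → ℝ}
    {R : ℝ} (hR : 0 ≤ R) (hy : ∀ i, vecNorm (y i) ≤ R) (B B₂ : ℝ) :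
    ∃ S : Finset (Matrix (Fin p) (Fin q) ℝ), S.card ≤ (2 * (2 * Fintype.card ι + 1) ^ 2) ^ n ∧
      (∀ V ∈ S, spectralNorm V ≤ B₂) ∧
      ∀ W : Matrix (Fin p) (Fin q) ℝ, norm21 W ≤ B → spectralNorm W ≤ B₂ →
        ∃ π : Equiv.Perm (Fin q), ∃ V ∈ S, ∀ i,
          vecNorm (Matrix.vecMul (y i) (W.submatrix id π) - Matrix.vecMul (y i) V)
            ≤ R * (6 * B / √(n + 1)) := by
  obtain ⟨S, hS, hS'⟩ := exists_cover_norm21_perm q n hR hy B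
  set e := R * (3 * B / √(n + 1)) with he
  let close : Matrix (Fin p) (Fin q) ℝ → (ι → Fin q → ℝ) → Prop := fun V A =>
    ∀ i, vecNorm (Matrix.vecMul (y i) V - A i) ≤ e
  -- The class is restricted to matrices near some element of `S`, because a given `W` is known to
  -- be covered only after its columns are permuted.
  obtain ⟨S', hS'S, hP, hc⟩ := exists_proper_cover
    (fun V => spectralNorm V ≤ B₂ ∧ ∃ A ∈ S, close V A) close S fun _ hV => hV.2
  refine ⟨S', hS'S.trans hS, fun V hV => (hP V hV).1, fun W hW hW₂ => ?_⟩
  obtain ⟨π, A, hA, hAW⟩ := hS' W hW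
  obtain ⟨V, hV, s, h1, h2⟩ := hc (W.submatrix id π)
    ⟨(spectralNorm_submatrix_col W π).trans hW₂, A, hA, hAW⟩
  refine ⟨π, V, hV, fun i => (vecNorm_sub_le_add _ (s i) _).trans ?_⟩
  have h3 := h1 i
  have h4 := h2 i
  rw [vecNorm_sub_rev] at h4
  have h5 : R * (6 * B / √(n + 1)) = e + e := by rw [he]; ring
  rw [h5]
  exact add_le_add h3 h4

/-! ### One block, row by row -/

/-- The rows of the attention score matrix, in terms of the product matrix `M = W_K W_Qᵀ`. -/
def scores {d T : ℕ} (M : Matrix (Fin d) (Fin d) ℝ) (Z : Matrix (Fin T) (Fin d) ℝ)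
    (t s : Fin T) : ℝ :=
  Matrix.vecMul (Z s) M ⬝ᵥ Z t

/-- The average of the rows of `Z` with softmax weights. -/
noncomputable def softAvg {d T : ℕ} (u : Fin T → ℝ) (Z : Matrix (Fin T) (Fin d) ℝ) : Fin d → ℝ :=
  Matrix.vecMul (softmaxVec u) Z

/-- The part of a block that follows the averaging over positions, on one row. -/
noncomputable def rowHead {d k : ℕ} (σ : ℝ → ℝ) (V : Matrix (Fin d) (Fin k) ℝ)
    (C : Matrix (Fin k) (Fin d) ℝ) (y : Fin d → ℝ) : Fin d → ℝ :=
  projBall (Matrix.vecMul (σ ∘ projBall (Matrix.vecMul y V)) C)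

/-- Queries and keys act only through `W_K W_Qᵀ`, so this product is covered as a single matrix. -/
theorem scores_eq {d k T : ℕ} (W : LayerWeights d k) (Z : Matrix (Fin T) (Fin d) ℝ)
    (t : Fin T) :
    ((Z * W.WQ) * (Z * W.WK).transpose) t = scores (W.WK * W.WQ.transpose) Z t := by
  ext s
  calc Matrix.vecMul (Z t) W.WQ ⬝ᵥ Matrix.vecMul (Z s) W.WK
      = Matrix.vecMul (Z s) W.WK ⬝ᵥ W.WQ.transpose.mulVec (Z t) := by
        rw [dotProduct_comm, Matrix.mulVec_transpose]
    _ = scores (W.WK * W.WQ.transpose) Z t s := by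
        rw [Matrix.dotProduct_mulVec, Matrix.vecMul_vecMul, scores]

theorem block_apply {d k T : ℕ} (σ : ℝ → ℝ) (W : LayerWeights d k) (Z : Matrix (Fin T) (Fin d) ℝ)
    (t : Fin T) : block σ W Z t
      = rowHead σ W.WV W.WC (softAvg (scores (W.WK * W.WQ.transpose) Z t) Z) := by
  have h : attention W Z t
      = Matrix.vecMul (softAvg (scores (W.WK * W.WQ.transpose) Z t) Z) W.WV := by
    rw [← scores_eq]; rfl
  rw [rowHead, ← h]
  rfl

/-- Relabelling the hidden units changes nothing, since the entrywise activation and the radial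
projection commute with permutations of the coordinates. -/
theorem rowHead_submatrix {d k : ℕ} (σ : ℝ → ℝ) (V : Matrix (Fin d) (Fin k) ℝ)
    (C : Matrix (Fin k) (Fin d) ℝ) (π : Equiv.Perm (Fin k)) (y : Fin d → ℝ) :
    rowHead σ (V.submatrix id π) (C.submatrix π id) y = rowHead σ V C y := by
  have h1 : Matrix.vecMul y (V.submatrix id π) = Matrix.vecMul y V ∘ π := rfl
  have h2 : ∀ x : Fin k → ℝ, σ ∘ projBall (x ∘ π) = (σ ∘ projBall x) ∘ π := fun x => by
    ext j; simp [projBall, vecNorm_comp_equiv]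
  rw [rowHead, h1, h2, vecMul_submatrix_row, rowHead]

theorem vecNorm_softAvg_le {d T : ℕ} (u : Fin T → ℝ) {Z : Matrix (Fin T) (Fin d) ℝ} {R : ℝ}
    (hR : 0 ≤ R) (hZ : ∀ t, vecNorm (Z t) ≤ R) : vecNorm (softAvg u Z) ≤ R := by
  rw [softAvg, Matrix.vecMul_eq_sum]
  refine (vecNorm_sum_le _ _).trans ?_
  calc ∑ s, vecNorm (softmaxVec u s • Z s) ≤ ∑ s, softmaxVec u s * R :=
        Finset.sum_le_sum fun s _ => by
          rw [vecNorm_smul, abs_of_nonneg (softmaxVec_nonneg u s)]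
          exact mul_le_mul_of_nonneg_left (hZ s) (softmaxVec_nonneg u s)
    _ ≤ R := by
        rw [← Finset.sum_mul]
        exact mul_le_of_le_one_left hR (sum_softmaxVec_le u)

/-- Split into averaging `Z - Z'` with the weights of `u`, and changing the weights on `Z'`; the
latter costs the `ℓ¹` distance of the two softmax vectors. -/
theorem vecNorm_softAvg_sub_le {d T : ℕ} {u v : Fin T → ℝ} {Z Z' : Matrix (Fin T) (Fin d) ℝ}
    {R δ η : ℝ} (hZ' : ∀ t, vecNorm (Z' t) ≤ R) (hδ : 0 ≤ δ) (hη : 0 ≤ η) (hR : 0 ≤ R)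
    (huv : ∀ s, |u s - v s| ≤ δ) (hZZ' : ∀ t, vecNorm (Z t - Z' t) ≤ η) :
    vecNorm (softAvg u Z - softAvg v Z') ≤ η + 2 * δ * R := by
  have e : softAvg u Z - softAvg v Z'
      = softAvg u (Z - Z') + ∑ s, (softmaxVec u s - softmaxVec v s) • Z' s := by
    simp only [softAvg, Matrix.vecMul_sub, sub_smul, Finset.sum_sub_distrib,
      ← Matrix.vecMul_eq_sum]
    abel
  rw [e]
  refine (vecNorm_add_le _ _).trans (add_le_add (vecNorm_softAvg_le u hη hZZ') ?_)
  refine (vecNorm_sum_le _ _).trans ?_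
  calc ∑ s, vecNorm ((softmaxVec u s - softmaxVec v s) • Z' s)
      ≤ ∑ s, |softmaxVec u s - softmaxVec v s| * R := Finset.sum_le_sum fun s _ => by
        rw [vecNorm_smul]
        exact mul_le_mul_of_nonneg_left (hZ' s) (abs_nonneg _)
    _ ≤ 2 * δ * R := by
        rw [← Finset.sum_mul]
        exact mul_le_mul_of_nonneg_right (sum_abs_softmaxVec_sub_le u v hδ huv) hR

theorem abs_scores_sub_le {d T : ℕ} {M : Matrix (Fin d) (Fin d) ℝ}
    {Z Z' : Matrix (Fin T) (Fin d) ℝ} {R η b : ℝ} (hM : spectralNorm M ≤ b)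
    (hZ : ∀ t, vecNorm (Z t) ≤ R) (hZ' : ∀ t, vecNorm (Z' t) ≤ R)
    (hZZ' : ∀ t, vecNorm (Z t - Z' t) ≤ η) (t s : Fin T) :
    |scores M Z t s - scores M Z' t s| ≤ 2 * R * b * η := by
  have hb := (spectralNorm_nonneg M).trans hM
  have hR := (vecNorm_nonneg _).trans (hZ t)
  have hη := (vecNorm_nonneg _).trans (hZZ' t)
  have e : scores M Z t s - scores M Z' t s = Matrix.vecMul (Z s - Z' s) M ⬝ᵥ Z t
      + Matrix.vecMul (Z' s) M ⬝ᵥ (Z t - Z' t) := by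
    simp only [scores, Matrix.sub_vecMul, sub_dotProduct, dotProduct_sub]
    ring
  have h : ∀ (x z : Fin d → ℝ) (a c : ℝ), vecNorm x ≤ a → vecNorm z ≤ c →
      |Matrix.vecMul x M ⬝ᵥ z| ≤ b * a * c := fun x z a c hx hz => by
    have ha := (vecNorm_nonneg _).trans hx
    refine (abs_dotProduct_le _ _).trans (mul_le_mul ?_ hz (vecNorm_nonneg _) (by positivity))
    exact (vecNorm_vecMul_le_spectralNorm x M).trans (mul_le_mul hM hx (vecNorm_nonneg _) hb)
  rw [e]
  refine (abs_add_le _ _).trans ((add_le_add (h _ _ _ _ (hZZ' s) (hZ t))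
    (h _ _ _ _ (hZ' s) (hZZ' t))).trans_eq (by ring))

theorem vecNorm_activation_sub_le {d k : ℕ} {σ : ℝ → ℝ} {Lσ : ℝ≥0} (hσ : LipschitzWith Lσ σ)
    (x x' : Fin k → ℝ) {C : Matrix (Fin k) (Fin d) ℝ} {c : ℝ} (hC : spectralNorm C ≤ c) :
    vecNorm (Matrix.vecMul (σ ∘ projBall x) C - Matrix.vecMul (σ ∘ projBall x') C)
      ≤ Lσ * c * vecNorm (x - x') := by
  have hc := (spectralNorm_nonneg C).trans hC
  rw [← Matrix.sub_vecMul]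
  refine (vecNorm_vecMul_le_spectralNorm _ _).trans ?_
  refine (mul_le_mul hC ((vecNorm_comp_sub_le hσ _ _).trans (mul_le_mul_of_nonneg_left
    (vecNorm_projBall_sub_le x x') Lσ.2)) (vecNorm_nonneg _) hc).trans_eq (by ring)

theorem vecNorm_rowHead_sub_le {d k : ℕ} {σ : ℝ → ℝ} {Lσ : ℝ≥0} (hσ : LipschitzWith Lσ σ)
    {V : Matrix (Fin d) (Fin k) ℝ} {C : Matrix (Fin k) (Fin d) ℝ} {v c : ℝ}
    (hV : spectralNorm V ≤ v) (hC : spectralNorm C ≤ c) (y y' : Fin d → ℝ) :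
    vecNorm (rowHead σ V C y - rowHead σ V C y') ≤ Lσ * c * v * vecNorm (y - y') := by
  have hc := (spectralNorm_nonneg C).trans hC
  refine (vecNorm_projBall_sub_le _ _).trans ((vecNorm_activation_sub_le hσ _ _ hC).trans ?_)
  rw [← Matrix.sub_vecMul, mul_assoc _ v]
  refine mul_le_mul_of_nonneg_left ?_ (mul_nonneg Lσ.2 hc)
  exact (vecNorm_vecMul_le_spectralNorm _ _).trans
    (mul_le_mul_of_nonneg_right hV (vecNorm_nonneg _))

theorem vecNorm_block_sub_le {d k T : ℕ} {σ : ℝ → ℝ} {Lσ : ℝ≥0} (hσ : LipschitzWith Lσ σ)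
    {B : LayerBounds} {W : LayerWeights d k} (hW : W.Obeys B) {Z Z' : Matrix (Fin T) (Fin d) ℝ}
    {R η : ℝ} (hZ : ∀ t, vecNorm (Z t) ≤ R) (hZ' : ∀ t, vecNorm (Z' t) ≤ R)
    (hZZ' : ∀ t, vecNorm (Z t - Z' t) ≤ η) (t : Fin T) :
    vecNorm (block σ W Z t - block σ W Z' t)
      ≤ Lσ * B.BC * B.BV * (1 + 4 * R ^ 2 * B.BQK) * η := by
  obtain ⟨h1, h2, h3, -⟩ := hW
  have hR := (vecNorm_nonneg _).trans (hZ t)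
  have hη := (vecNorm_nonneg _).trans (hZZ' t)
  have b1 := (spectralNorm_nonneg _).trans h1
  have b2 := (spectralNorm_nonneg _).trans h2
  have b3 := (spectralNorm_nonneg _).trans h3
  rw [block_apply, block_apply]
  refine (vecNorm_rowHead_sub_le hσ h2 h3 _ _).trans ?_
  rw [mul_assoc (Lσ * B.BC * B.BV)]
  refine mul_le_mul_of_nonneg_left ?_ (mul_nonneg (mul_nonneg Lσ.2 b3) b2)
  refine (vecNorm_softAvg_sub_le hZ' (δ := 2 * R * B.BQK * η) (by positivity) hη hR
    (abs_scores_sub_le h1 hZ hZ' hZZ' t) hZZ').trans_eq (by ring)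

/-- The bound `1` from the projection serves the layer-wise estimate; the bound `v * R` keeps the
linear dependence on the input radius for the simplified one. -/
theorem vecNorm_activation_le {d k : ℕ} {σ : ℝ → ℝ} {Lσ : ℝ≥0} (hσ : LipschitzWith Lσ σ)
    (h0 : σ 0 = 0) {V : Matrix (Fin d) (Fin k) ℝ} {v R : ℝ} (hV : spectralNorm V ≤ v)
    {y : Fin d → ℝ} (hy : vecNorm y ≤ R) :
    vecNorm (σ ∘ projBall (Matrix.vecMul y V)) ≤ Lσ * min 1 (v * R) := by
  refine (vecNorm_comp_le hσ h0 _).trans (mul_le_mul_of_nonneg_left (le_min ?_ ?_) Lσ.2)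
  · exact vecNorm_projBall_le_one _
  · exact (vecNorm_projBall_le _).trans ((vecNorm_vecMul_le_spectralNorm _ _).trans
      (mul_le_mul hV hy (vecNorm_nonneg _) ((spectralNorm_nonneg V).trans hV)))

theorem vecNorm_block_le_one {d k T : ℕ} (σ : ℝ → ℝ) (W : LayerWeights d k)
    (Z : Matrix (Fin T) (Fin d) ℝ) (t : Fin T) : vecNorm (block σ W Z t) ≤ 1 := by
  rw [block_apply]
  exact vecNorm_projBall_le_one _

/-- Both norms of `W_C` dominate its action on rows. The spectral bound propagates the radii through
the network; the `(2,1)` bound, used at the last block, makes the readout term proportional to it.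
-/
theorem vecNorm_block_le {d k T : ℕ} {σ : ℝ → ℝ} {Lσ : ℝ≥0} (hσ : LipschitzWith Lσ σ)
    (h0 : σ 0 = 0) {B : LayerBounds} {W : LayerWeights d k} (hW : W.Obeys B)
    {Z : Matrix (Fin T) (Fin d) ℝ} {R : ℝ} (hZ : ∀ t, vecNorm (Z t) ≤ R) (t : Fin T) :
    vecNorm (block σ W Z t) ≤ min B.BC B.BC21 * (Lσ * (B.BV * R)) := by
  obtain ⟨-, h2, h3, -, -, h6⟩ := hW
  have hR := (vecNorm_nonneg _).trans (hZ t)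
  have b3 := (spectralNorm_nonneg _).trans h3
  have b6 := (norm21_nonneg _).trans h6
  rw [block_apply]
  refine (vecNorm_projBall_le _).trans ?_
  have ha := (vecNorm_activation_le hσ h0 h2 (vecNorm_softAvg_le (scores
    (W.WK * W.WQ.transpose) Z t) hR hZ)).trans
      (mul_le_mul_of_nonneg_left (min_le_right _ _) Lσ.2)
  rcases min_choice B.BC B.BC21 with h | h <;> rw [h]
  · exact (vecNorm_vecMul_le_spectralNorm _ _).trans (mul_le_mul h3 ha (vecNorm_nonneg _) b3)
  · exact (vecNorm_vecMul_le_norm21 _ _).trans (mul_le_mul h6 ha (vecNorm_nonneg _) b6)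

/-! ### Covers of one block -/

/-- The constant is at most `18 ≤ 2 ^ 6` and is absorbed by six further powers of `d * m * T ≥ 2`.
-/
theorem cover_card_le {d m T : ℕ} (hD : 2 ≤ d * m * T) :
    (d + 1) * (2 * (m * T) + 1) ^ 2 ≤ (d * m * T) ^ 8 := by
  rw [mul_assoc] at *
  generalize m * T = N at *
  have hd : 1 ≤ d := Nat.one_le_iff_ne_zero.2 (by rintro rfl; simp at hD)
  have hN : 1 ≤ N := Nat.one_le_iff_ne_zero.2 (by rintro rfl; simp at hD)
  calc (d + 1) * (2 * N + 1) ^ 2 ≤ (2 * d) * (3 * N) ^ 2 := by gcongr <;> omega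
    _ ≤ 2 ^ 6 * (d * N) ^ 2 := by
      have : d * N ^ 2 ≤ d ^ 2 * N ^ 2 := Nat.mul_le_mul_right _ (Nat.le_self_pow two_ne_zero d)
      rw [mul_pow, mul_pow]
      nlinarith [Nat.zero_le (d ^ 2 * N ^ 2)]
    _ ≤ (d * N) ^ 6 * (d * N) ^ 2 := by gcongr
    _ = (d * N) ^ 8 := by rw [← pow_add]

theorem cover_perm_card_le {d m T : ℕ} (hD : 2 ≤ d * m * T) :
    2 * (2 * (m * T) + 1) ^ 2 ≤ (d * m * T) ^ 8 := by
  refine le_trans (Nat.mul_le_mul_right _ ?_) (cover_card_le hD)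
  have hd : d ≠ 0 := by rintro rfl; simp at hD
  omega

/-- The accuracy of the cover of one block on inputs with rows in the ball of radius `R`, with
budgets `n₁, n₂, n₃` for the three weight matrices. -/
noncomputable def layerError (B : LayerBounds) (Lσ R : ℝ) (n₁ n₂ n₃ : ℕ) : ℝ :=
  Lσ * min 1 (B.BV * R) * B.BC21 / √(n₁ + 1)
    + R ^ 3 * (2 * Lσ * B.BC * B.BV * B.BQK21) / √(n₂ + 1)
    + R * (Lσ * B.BC * B.BV21) / √(n₃ + 1)

theorem exists_layer_cover {d k T m : ℕ} {σ : ℝ → ℝ} {Lσ : ℝ≥0} (hσ : LipschitzWith Lσ σ)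
    (h0 : σ 0 = 0) {B : LayerBounds} (hB : B.Nonneg) {R : ℝ} (hR : 0 ≤ R) (hD : 2 ≤ d * m * T)
    (Z : Fin m → Matrix (Fin T) (Fin d) ℝ) (hZ : ∀ i t, vecNorm (Z i t) ≤ R) (n₁ n₂ n₃ : ℕ) :
    ∃ S : Finset (LayerWeights d k), S.card ≤ (d * m * T) ^ (8 * (n₁ + n₂ + n₃)) ∧
      (∀ W ∈ S, W.Obeys B) ∧ ∀ W : LayerWeights d k, W.Obeys B → ∃ W' ∈ S, ∀ i t,
        vecNorm (block σ W (Z i) t - block σ W' (Z i) t) ≤ 12 * layerError B Lσ R n₁ n₂ n₃ := by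
  classical
  obtain ⟨hQK, hV, hC, hQK21, hV21, hC21⟩ := hB
  -- The first summand is the error of covering `W_C` on approximate activations. The second is the
  -- error of the values and of the attention weights, passed through `σ` and `W_C`.
  set e := Lσ * min 1 (B.BV * R) * (3 * B.BC21 / √(n₁ + 1))
    + Lσ * B.BC * (R * (6 * B.BV21 / √(n₃ + 1))
      + B.BV * (2 * (R * (3 * B.BQK21 / √(n₂ + 1)) * R) * R)) with he
  let close : LayerWeights d k → (Fin m × Fin T → Fin d → ℝ) → Prop := fun W A =>
    ∀ x, vecNorm (block σ W (Z x.1) x.2 - A x) ≤ e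
  have hcover : ∃ S : Finset (Fin m × Fin T → Fin d → ℝ),
      S.card ≤ (d * m * T) ^ (8 * (n₁ + n₂ + n₃)) ∧
      ∀ W : LayerWeights d k, W.Obeys B → ∃ A ∈ S, close W A := by
    obtain ⟨S₂, hS₂, hS₂'⟩ := exists_cover_norm21 (ι := Fin m × Fin T) d n₂
      (y := fun x => Z x.1 x.2) hR (fun x => hZ _ _) B.BQK21
    let Y : (Fin m × Fin T → Fin d → ℝ) → Fin m × Fin T → Fin d → ℝ := fun A x =>
      softAvg (fun s => A (x.1, s) ⬝ᵥ Z x.1 x.2) (Z x.1)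
    have hY : ∀ A x, vecNorm (Y A x) ≤ R := fun A x => vecNorm_softAvg_le _ hR (hZ x.1)
    -- The values need a cover by genuine matrices with spectral norm at most `B.BV`: only then are
    -- the activations `U` bounded by `Lσ * min 1 (B.BV * R)`, the radius for the cover of `W_C`.
    choose S₃ hS₃ hS₃V hS₃' using fun A =>
      exists_proper_cover_perm (ι := Fin m × Fin T) k n₃ hR (hY A) B.BV21 B.BV
    let U : (Fin m × Fin T → Fin d → ℝ) → Matrix (Fin d) (Fin k) ℝ → Fin m × Fin T → Fin k → ℝ :=
      fun A V x => σ ∘ projBall (Matrix.vecMul (Y A x) V)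
    have hρ : 0 ≤ Lσ * min 1 (B.BV * R) := mul_nonneg Lσ.2 (le_min zero_le_one (by positivity))
    have hU : ∀ A, ∀ V : S₃ A, ∀ x, vecNorm (U A V x) ≤ Lσ * min 1 (B.BV * R) := fun A V x =>
      vecNorm_activation_le hσ h0 (hS₃V A V V.2) (hY A x)
    choose S₁ hS₁ hS₁' using fun A => fun V : S₃ A =>
      exists_cover_norm21 (ι := Fin m × Fin T) d n₁ hρ (hU A V) B.BC21
    refine ⟨S₂.biUnion fun A => (S₃ A).attach.biUnion fun V => (S₁ A V).image fun G x =>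
      projBall (G x), ?_, fun W hW => ?_⟩
    · have hN : Fintype.card (Fin m × Fin T) = m * T := by simp
      rw [hN] at hS₂ hS₃ hS₁
      have h₁ : ∀ A V, (S₁ A V).card ≤ (d * m * T) ^ (8 * n₁) := fun A V => by
        rw [pow_mul]; exact (hS₁ A V).trans (Nat.pow_le_pow_left (cover_card_le hD) _)
      have h₂ : S₂.card ≤ (d * m * T) ^ (8 * n₂) := by
        rw [pow_mul]; exact hS₂.trans (Nat.pow_le_pow_left (cover_card_le hD) _)
      have h₃ : ∀ A, (S₃ A).card ≤ (d * m * T) ^ (8 * n₃) := fun A => by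
        rw [pow_mul]; exact (hS₃ A).trans (Nat.pow_le_pow_left (cover_perm_card_le hD) _)
      calc _ ≤ S₂.card * ((d * m * T) ^ (8 * n₃) * (d * m * T) ^ (8 * n₁)) :=
            Finset.card_biUnion_le_card_mul _ _ _ fun A _ =>
              (Finset.card_biUnion_le_card_mul _ _ _ fun V _ =>
                Finset.card_image_le.trans (h₁ A V)).trans
                  (Nat.mul_le_mul_right _ ((Finset.card_attach).trans_le (h₃ A)))
        _ ≤ (d * m * T) ^ (8 * n₂) * ((d * m * T) ^ (8 * n₃) * (d * m * T) ^ (8 * n₁)) :=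
            Nat.mul_le_mul_right _ h₂
        _ = (d * m * T) ^ (8 * (n₁ + n₂ + n₃)) := by
            rw [← pow_add, ← pow_add]; congr 1; ring
    · obtain ⟨w1, w2, w3, w4, w5, w6⟩ := hW
      obtain ⟨A, hA, hA'⟩ := hS₂' _ w4
      obtain ⟨π, V, hV, hV'⟩ := hS₃' A _ w5 w2
      have hC' : norm21 (W.WC.submatrix π id) ≤ B.BC21 := by rwa [norm21_submatrix_row]
      have hCs : spectralNorm (W.WC.submatrix π id) ≤ B.BC :=
        (spectralNorm_submatrix_row _ _).trans w3
      have hVs : spectralNorm (W.WV.submatrix id π) ≤ B.BV :=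
        (spectralNorm_submatrix_col _ _).trans w2
      obtain ⟨G, hG, hG'⟩ := hS₁' A ⟨V, hV⟩ _ hC'
      refine ⟨fun x => projBall (G x), ?_, fun x => ?_⟩
      · exact Finset.mem_biUnion.2 ⟨A, hA, Finset.mem_biUnion.2 ⟨⟨V, hV⟩, Finset.mem_attach _ _,
          Finset.mem_image_of_mem _ hG⟩⟩
      -- The permutation found for `W_V` is applied to the rows of `W_C` as well, which leaves the
      -- block unchanged.
      rw [block_apply, ← rowHead_submatrix σ _ _ π]
      set y := softAvg (scores (W.WK * W.WQ.transpose) (Z x.1) x.2) (Z x.1) with hy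
      have hyY : vecNorm (y - Y A x) ≤ 2 * (R * (3 * B.BQK21 / √(n₂ + 1)) * R) * R := by
        refine (vecNorm_softAvg_sub_le (hZ x.1) (δ := R * (3 * B.BQK21 / √(n₂ + 1)) * R)
          (by positivity) le_rfl hR (fun s => ?_) fun t => by simp [vecNorm_zero]).trans_eq
            (zero_add _)
        rw [scores, ← sub_dotProduct]
        exact (abs_dotProduct_le _ _).trans (mul_le_mul (hA' (x.1, s)) (hZ _ _)
          (vecNorm_nonneg _) (by positivity))
      refine (vecNorm_projBall_sub_le _ _).trans ((vecNorm_sub_le_add _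
        (Matrix.vecMul (U A V x) (W.WC.submatrix π id)) _).trans ?_)
      rw [add_comm, he]
      refine add_le_add (hG' x) ((vecNorm_activation_sub_le hσ _ _ hCs).trans
        (mul_le_mul_of_nonneg_left ?_ (mul_nonneg Lσ.2 hC)))
      refine (vecNorm_sub_le_add _ (Matrix.vecMul (Y A x) (W.WV.submatrix id π)) _).trans ?_
      rw [add_comm]
      refine add_le_add (hV' x) ?_
      rw [← Matrix.sub_vecMul]
      exact (vecNorm_vecMul_le_spectralNorm _ _).trans
        (mul_le_mul hVs hyY (vecNorm_nonneg _) ((spectralNorm_nonneg _).trans hVs))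
  obtain ⟨S, hS, hS'⟩ := hcover
  -- Returning to admissible weights doubles the error, but lets the next layer be covered on
  -- outputs of actual networks.
  obtain ⟨S', hS'S, hP, hc⟩ := exists_proper_cover (fun W : LayerWeights d k => W.Obeys B)
    close S hS'
  refine ⟨S', hS'S.trans hS, hP, fun W hW => ?_⟩
  obtain ⟨W', hW', A, h1, h2⟩ := hc W hW
  refine ⟨W', hW', fun i t => (vecNorm_sub_le_add _ (A (i, t)) _).trans ?_⟩
  have h3 := h1 (i, t)
  have h4 := h2 (i, t)
  rw [vecNorm_sub_rev] at h4
  refine (add_le_add h3 h4).trans ?_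
  have hmin : 0 ≤ min 1 (B.BV * R) := le_min zero_le_one (by positivity)
  have h5 : 0 ≤ Lσ * min 1 (B.BV * R) * B.BC21 / √(n₁ + 1) := by positivity
  have h6 : e + e = 12 * layerError B Lσ R n₁ n₂ n₃
      - 6 * (Lσ * min 1 (B.BV * R) * B.BC21 / √(n₁ + 1))
      - 6 * (R ^ 3 * (2 * Lσ * B.BC * B.BV * B.BQK21) / √(n₂ + 1)) := by
    rw [he, layerError]; ring
  have h7 : 0 ≤ R ^ 3 * (2 * Lσ * B.BC * B.BV * B.BQK21) / √(n₂ + 1) := by positivity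
  rw [h6]; linarith

/-! ### Composition of blocks -/

theorem prod_Ioi_castSucc {L : ℕ} (f : Fin (L + 1) → ℝ) (i : Fin L) :
    ∏ j ∈ Finset.Ioi i.castSucc, f j
      = (∏ j ∈ Finset.Ioi i, f j.castSucc) * f (Fin.last L) := by
  rw [← Finset.filter_lt_eq_Ioi, ← Finset.filter_lt_eq_Ioi, Finset.prod_filter, Finset.prod_filter,
    Fin.prod_univ_castSucc]
  simp [Fin.castSucc_lt_last]

theorem prod_Ioi_last {L : ℕ} (f : Fin (L + 1) → ℝ) :
    ∏ j ∈ Finset.Ioi (Fin.last L), f j = 1 := by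
  rw [Finset.prod_eq_one]
  intro j hj
  exact absurd (Finset.mem_Ioi.1 hj) (not_lt.2 (Fin.le_last j))

theorem tfBlock_snoc {d k T L : ℕ} (σ : ℝ → ℝ) (W : Fin L → LayerWeights d k)
    (w : LayerWeights d k) (X : Matrix (Fin T) (Fin d) ℝ) :
    tfBlock σ (L + 1) (Fin.snoc W w : Fin (L + 1) → LayerWeights d k) X
      = block σ w (tfBlock σ L W X) := by
  simp [tfBlock]

theorem vecNorm_tfBlock_le {d k T L : ℕ} {σ : ℝ → ℝ} {B : Fin L → LayerBounds}
    {r : Fin (L + 1) → ℝ}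
    (hr : ∀ i, ∀ W : LayerWeights d k, W.Obeys (B i) → ∀ Z : Matrix (Fin T) (Fin d) ℝ,
      (∀ t, vecNorm (Z t) ≤ r i.castSucc) → ∀ t, vecNorm (block σ W Z t) ≤ r i.succ)
    {W : Fin L → LayerWeights d k} (hW : ∀ i, (W i).Obeys (B i)) {X : Matrix (Fin T) (Fin d) ℝ}
    (hX : ∀ t, vecNorm (X t) ≤ r 0) (t : Fin T) : vecNorm (tfBlock σ L W X t) ≤ r (Fin.last L) := by
  induction L generalizing t with
  | zero => exact hX t
  | succ L ih =>
    exact hr (Fin.last L) _ (hW _) _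
      (ih (B := fun i => B i.castSucc) (r := fun i => r i.castSucc)
        (fun i => hr i.castSucc) (fun i => hW i.castSucc) hX) t

/-- Lipschitz bound of a block on inputs with rows in the ball of radius `R`. -/
def blockLip (B : LayerBounds) (Lσ R : ℝ) : ℝ := Lσ * B.BC * B.BV * (1 + 4 * R ^ 2 * B.BQK)

/-- For each prefix in the cover, the last block gets its own cover on the outputs of that prefix;
cardinalities multiply. The prefix error passes through the true last block, hence its Lipschitz
factor, and the new error is added. -/
theorem exists_network_cover {d k T m L : ℕ} {σ : ℝ → ℝ} {Lσ : ℝ≥0} (hσ : LipschitzWith Lσ σ)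
    (h0 : σ 0 = 0) {B : Fin L → LayerBounds} (hB : ∀ i, (B i).Nonneg) {r : Fin (L + 1) → ℝ}
    (hr0 : ∀ i, 0 ≤ r i)
    (hr : ∀ i, ∀ W : LayerWeights d k, W.Obeys (B i) → ∀ Z : Matrix (Fin T) (Fin d) ℝ,
      (∀ t, vecNorm (Z t) ≤ r i.castSucc) → ∀ t, vecNorm (block σ W Z t) ≤ r i.succ)
    (hD : 2 ≤ d * m * T) (X : Fin m → Matrix (Fin T) (Fin d) ℝ)
    (hX : ∀ i t, vecNorm (X i t) ≤ r 0) (n₁ n₂ n₃ : Fin L → ℕ) :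
    ∃ S : Finset (Fin L → LayerWeights d k),
      S.card ≤ (d * m * T) ^ (8 * ∑ i, (n₁ i + n₂ i + n₃ i)) ∧
      (∀ W ∈ S, ∀ i, (W i).Obeys (B i)) ∧
      ∀ W : Fin L → LayerWeights d k, (∀ i, (W i).Obeys (B i)) → ∃ W' ∈ S, ∀ i t,
        vecNorm (tfBlock σ L W (X i) t - tfBlock σ L W' (X i) t)
          ≤ 12 * ∑ i, (∏ j ∈ Finset.Ioi i, blockLip (B j) Lσ (r j.castSucc))
              * layerError (B i) Lσ (r i.castSucc) (n₁ i) (n₂ i) (n₃ i) := by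
  classical
  induction L with
  | zero =>
    exact ⟨{Fin.elim0}, by simp, fun W _ i => i.elim0, fun W _ => ⟨Fin.elim0, by simp, fun i t => by
      simp [tfBlock, vecNorm_zero]⟩⟩
  | succ L ih =>
    have hr' := fun i : Fin L => hr i.castSucc
    obtain ⟨S, hS, hSB, hS'⟩ := ih (B := fun i => B i.castSucc) (r := fun i => r i.castSucc)
      (fun i => hB _) (fun i => hr0 _) hr' hX (fun i => n₁ i.castSucc) (fun i => n₂ i.castSucc)
      (fun i => n₃ i.castSucc)
    have hZ : ∀ W : Fin L → LayerWeights d k, (∀ i, (W i).Obeys (B i.castSucc)) → ∀ i t,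
        vecNorm (tfBlock σ L W (X i) t) ≤ r (Fin.last L).castSucc := fun W hW i =>
      vecNorm_tfBlock_le (B := fun i => B i.castSucc) (r := fun i => r i.castSucc) hr' hW (hX i)
    choose S₁ hS₁ hS₁B hS₁' using fun W : S => exists_layer_cover (k := k) hσ h0 (hB (Fin.last L))
      (hr0 _) hD (fun i => tfBlock σ L W.1 (X i)) (hZ W.1 (hSB _ W.2)) (n₁ (Fin.last L))
        (n₂ (Fin.last L)) (n₃ (Fin.last L))
    refine ⟨S.attach.biUnion fun W => (S₁ W).image fun w =>
      (Fin.snoc W.1 w : Fin (L + 1) → LayerWeights d k), ?_, fun W hW i => ?_, fun W hW => ?_⟩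
    · refine (Finset.card_biUnion_le_card_mul _ _ _ fun W _ =>
        Finset.card_image_le.trans (hS₁ W)).trans ?_
      rw [Finset.card_attach, Fin.sum_univ_castSucc, mul_add 8 (Finset.sum _ _), pow_add]
      exact Nat.mul_le_mul_right _ hS
    · obtain ⟨V, -, hV⟩ := Finset.mem_biUnion.1 hW
      obtain ⟨w, hw, rfl⟩ := Finset.mem_image.1 hV
      induction i using Fin.lastCases with
      | last => simpa using hS₁B V w hw
      | cast i => simpa using hSB _ V.2 i
    · obtain ⟨V, hV, hVW⟩ := hS' (fun i => W i.castSucc) fun i => hW _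
      obtain ⟨w, hw, hwW⟩ := hS₁' ⟨V, hV⟩ (W (Fin.last L)) (hW _)
      refine ⟨Fin.snoc V w, Finset.mem_biUnion.2 ⟨⟨V, hV⟩, Finset.mem_attach _ _,
        Finset.mem_image_of_mem _ hw⟩, fun i t => ?_⟩
      rw [tfBlock_snoc, Fin.sum_univ_castSucc, prod_Ioi_last, one_mul, mul_add]
      refine (vecNorm_sub_le_add _ (block σ (W (Fin.last L)) (tfBlock σ L V (X i)) t) _).trans
        (add_le_add ?_ (hwW i t))
      refine (vecNorm_block_sub_le hσ (hW _) (hZ _ (fun i => hW _) i) (hZ _ (hSB V hV) i)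
        (hVW i) t).trans_eq ?_
      simp only [prod_Ioi_castSucc, blockLip, Finset.mul_sum]
      exact Finset.sum_congr rfl fun i _ => by ring

/-! ### The scalar class -/

theorem sampleCoveringNumber_le_card {Z Y : Type*} [NormedAddCommGroup Y] {m : ℕ}
    {F : Set (Z → Y)} {ε : ℝ} {z : Fin m → Z} {S : Finset (Z → Y)}
    (h : IsSampleCover F ε z (S : Set (Z → Y))) :
    sampleCoveringNumber F ε z ≤ S.card :=
  (iInf₂_le _ h).trans_eq (Set.encard_coe_eq_coe_finsetCard S)

theorem sampleCoveringNumber_log_le {Z Y : Type*} [NormedAddCommGroup Y] {m : ℕ}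
    {F : Set (Z → Y)} {ε : ℝ} {z : Fin m → Z} {S : Finset (Z → Y)} {D N : ℕ} (hD : 1 ≤ D)
    (h : IsSampleCover F ε z (S : Set (Z → Y))) (hS : S.card ≤ D ^ N) :
    sampleCoveringNumber F ε z ≠ ⊤ ∧
      Real.log (sampleCoveringNumber F ε z).toNat ≤ N * Real.log D := by
  have hle := sampleCoveringNumber_le_card h
  have hD' : (1 : ℝ) ≤ D := by exact_mod_cast hD
  refine ⟨ne_top_of_le_ne_top (ENat.natCast_ne_top _) hle, ?_⟩
  have h1 : (sampleCoveringNumber F ε z).toNat ≤ D ^ N :=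
    (ENat.toNat_le_of_le_natCast hle).trans hS
  rcases (sampleCoveringNumber F ε z).toNat.eq_zero_or_pos with h2 | h2
  · rw [h2]
    simpa using mul_nonneg N.cast_nonneg (Real.log_nonneg hD')
  · rw [← Real.log_pow]
    exact Real.log_le_log (by exact_mod_cast h2) (by exact_mod_cast h1)

theorem exists_scalar_cover {d k T m L : ℕ} {σ : ℝ → ℝ} {Lσ : ℝ≥0} (hσ : LipschitzWith Lσ σ)
    (h0 : σ 0 = 0) {B : Fin L → LayerBounds} (hB : ∀ i, (B i).Nonneg) {r : Fin (L + 1) → ℝ}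
    (hr0 : ∀ i, 0 ≤ r i)
    (hr : ∀ i, ∀ W : LayerWeights d k, W.Obeys (B i) → ∀ Z : Matrix (Fin T) (Fin d) ℝ,
      (∀ t, vecNorm (Z t) ≤ r i.castSucc) → ∀ t, vecNorm (block σ W Z t) ≤ r i.succ)
    (hD : 2 ≤ d * m * T) (X : Fin m → Matrix (Fin T) (Fin d) ℝ)
    (hX : ∀ i t, vecNorm (X i t) ≤ r 0) {Bw ρ ε : ℝ} (hBw : 0 ≤ Bw) (hρ : 0 ≤ ρ) (cls : Fin T)
    (hXρ : ∀ W : Fin L → LayerWeights d k, (∀ i, (W i).Obeys (B i)) → ∀ i,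
      vecNorm (tfBlock σ L W (X i) cls) ≤ ρ) (n₀ : ℕ) (n₁ n₂ n₃ : Fin L → ℕ)
    (hε : Bw * (12 * ∑ i, (∏ j ∈ Finset.Ioi i, blockLip (B j) Lσ (r j.castSucc))
      * layerError (B i) Lσ (r i.castSucc) (n₁ i) (n₂ i) (n₃ i)) + 12 * (ρ * Bw) / √(n₀ + 1) ≤ ε) :
    sampleCoveringNumber (tfScalarClass d k L σ B Bw cls) ε X ≠ ⊤ ∧
      Real.log (sampleCoveringNumber (tfScalarClass d k L σ B Bw cls) ε X).toNat
        ≤ 8 * (n₀ + ∑ i, ((n₁ i : ℝ) + n₂ i + n₃ i)) * Real.log ((d : ℝ) * m * T) := by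
  classical
  obtain ⟨S, hS, hSB, hS'⟩ := exists_network_cover hσ h0 hB hr0 hr hD X hX n₁ n₂ n₃
  let g : (Fin L → LayerWeights d k) → Fin m → Fin d → ℝ := fun W i => tfBlock σ L W (X i) cls
  have hw : ∀ W : S, ∃ S₀ : Finset (Fin d → ℝ), S₀.card ≤ (d * m * T) ^ (8 * n₀) ∧
      (∀ w ∈ S₀, vecNorm w ≤ Bw) ∧ ∀ w, vecNorm w ≤ Bw → ∃ w' ∈ S₀, ∀ i,
        |w ⬝ᵥ g W i - w' ⬝ᵥ g W i| ≤ 12 * (ρ * Bw) / √(n₀ + 1) := fun W => by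
    -- The readout vector is a matrix with one column, whose `(2,1)` norm is its Euclidean norm.
    obtain ⟨S₁, h₁, h₁'⟩ := exists_cover_norm21 1 n₀ hρ (fun i => hXρ _ (hSB _ W.2) i) Bw
    let close : (Fin d → ℝ) → (Fin m → Fin 1 → ℝ) → Prop := fun w A =>
      ∀ i, |w ⬝ᵥ g W i - A i 0| ≤ ρ * (3 * Bw / √(n₀ + 1))
    obtain ⟨S₀, h₂, hP, hc⟩ := exists_proper_cover (fun w => vecNorm w ≤ Bw) close S₁
      fun w hw => by
        obtain ⟨A, hA, hAw⟩ := h₁' (fun a _ => w a) (by simpa [norm21] using hw)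
        refine ⟨A, hA, fun i => le_trans ?_ (hAw i)⟩
        rw [dotProduct_comm]
        refine abs_le_of_sq_le_sq ?_ (vecNorm_nonneg _)
        rw [vecNorm_sq]
        rw [Fin.sum_univ_one]
        exact le_rfl
    refine ⟨S₀, (h₂.trans h₁).trans ?_, hP, fun w hw => ?_⟩
    · rw [pow_mul]
      refine Nat.pow_le_pow_left (le_trans ?_ (cover_perm_card_le hD)) _
      have hT : 1 ≤ T := Nat.one_le_iff_ne_zero.2 (by rintro rfl; simp at hD)
      rw [Fintype.card_fin]
      gcongr
      exact Nat.le_mul_of_pos_right m hT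
    · obtain ⟨w', hw', A, h3, h4⟩ := hc w hw
      refine ⟨w', hw', fun i => ?_⟩
      have h5 := h3 i
      have h6 := h4 i
      rw [abs_sub_comm] at h6
      have h7 : 0 ≤ ρ * (3 * Bw / √(n₀ + 1)) := by positivity
      -- A factor `6` would do; `12` gives the readout term the same form as the layer terms.
      have h8 : 12 * (ρ * Bw) / √(n₀ + 1) = 4 * (ρ * (3 * Bw / √(n₀ + 1))) := by ring
      rw [h8]
      exact (abs_sub_le _ (A i 0) _).trans (by linarith)
  choose S₀ hS₀ hS₀w hS₀' using hw
  have hN : (d : ℝ) * m * T = ((d * m * T : ℕ) : ℝ) := by push_cast; ring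
  have key := sampleCoveringNumber_log_le (F := tfScalarClass d k L σ B Bw cls) (ε := ε) (z := X)
    (S := S.attach.biUnion fun W => (S₀ W).image fun w X => w ⬝ᵥ tfBlock σ L W.1 X cls)
    (D := d * m * T) (N := 8 * (n₀ + ∑ i, (n₁ i + n₂ i + n₃ i))) (by omega)
    ⟨fun f hf => ?_, fun f hf => ?_⟩ ?_
  · refine ⟨key.1, key.2.trans_eq ?_⟩
    rw [hN]; push_cast; rfl
  · obtain ⟨W, -, hW⟩ := Finset.mem_biUnion.1 (Finset.mem_coe.1 hf)
    obtain ⟨w, hw, rfl⟩ := Finset.mem_image.1 hW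
    exact ⟨W.1, w, hSB _ W.2, hS₀w W w hw, rfl⟩
  · obtain ⟨W, w, hW, hw, rfl⟩ := hf
    obtain ⟨V, hV, hVW⟩ := hS' W hW
    obtain ⟨w', hw', hww'⟩ := hS₀' ⟨V, hV⟩ w hw
    refine ⟨_, Finset.mem_coe.2 (Finset.mem_biUnion.2 ⟨⟨V, hV⟩, Finset.mem_attach _ _,
      Finset.mem_image_of_mem _ hw'⟩), fun i => ?_⟩
    rw [Real.norm_eq_abs]
    refine (abs_sub_le _ (w ⬝ᵥ g V i) _).trans (le_trans (add_le_add ?_ (hww' i)) hε)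
    rw [← dotProduct_sub]
    exact (abs_dotProduct_le _ _).trans (mul_le_mul hw (hVW i cls) (vecNorm_nonneg _) hBw)
  · refine (Finset.card_biUnion_le_card_mul _ _ _ fun W _ =>
      Finset.card_image_le.trans (hS₀ W)).trans ?_
    rw [Finset.card_attach, mul_add, pow_add, mul_comm]
    exact Nat.mul_le_mul_left _ hS

/-! ### Allocation of the accuracy -/

/-- The budget for an error term of size `x`, if all terms together have capacity `S ^ 3`. -/
noncomputable def budget (S ε x : ℝ) : ℕ := ⌊144 * x ^ (2 / 3 : ℝ) * S ^ 2 / ε ^ 2⌋₊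

theorem budget_le {S ε x : ℝ} (hx : 0 ≤ x) :
    (budget S ε x : ℝ) ≤ x ^ (2 / 3 : ℝ) * (144 * S ^ 2 / ε ^ 2) :=
  (Nat.floor_le (by positivity)).trans_eq (by ring)

/-- With `s = x ^ (2 / 3)` one has `x ^ 2 = s ^ 3`, so `n + 1 ≥ 144 * s * S ^ 2 / ε ^ 2` gives error
at most `s * ε / S`. These errors add up to at most `ε` when `S` is the sum of all `s`, and the
budgets then add up to at most `144 * S ^ 3 / ε ^ 2`. -/
theorem error_le_of_budget {S ε x : ℝ} (hx : 0 ≤ x) (hε : 0 < ε) (hS : x ^ (2 / 3 : ℝ) ≤ S) :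
    12 * x / √(budget S ε x + 1) ≤ x ^ (2 / 3 : ℝ) * (ε / S) := by
  set s := x ^ (2 / 3 : ℝ) with hs
  have hs0 : 0 ≤ s := Real.rpow_nonneg hx _
  have hxs : x ^ 2 = s ^ 3 := by
    rw [hs, ← Real.rpow_natCast, ← Real.rpow_natCast, ← Real.rpow_mul hx]
    norm_num
  rcases hs0.eq_or_lt with h | h
  · have : x = 0 := by
      rw [← h] at hxs
      simpa using hxs
    rw [this, ← h]; simp
  have hS0 : 0 < S := h.trans_le hS
  have hn : 144 * s * S ^ 2 / ε ^ 2 ≤ budget S ε x + 1 := (Nat.lt_floor_add_one _).le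
  rw [div_le_iff₀ (by positivity)] at hn
  refine abs_le_of_sq_le_sq' ?_ (by positivity) |>.2
  rw [div_pow, Real.sq_sqrt (by positivity), div_le_iff₀ (by positivity), mul_pow, hxs, mul_pow,
    div_pow, mul_div_assoc', div_mul_eq_mul_div, le_div_iff₀ (by positivity)]
  have := mul_le_mul_of_nonneg_left hn (sq_nonneg s)
  linarith

theorem lipAfter_nonneg {L : ℕ} {B : Fin L → LayerBounds} (hB : ∀ i, (B i).Nonneg) {Lσ : ℝ}
    (hL : 0 ≤ Lσ) (i : Fin L) : 0 ≤ lipAfter B Lσ i :=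
  Finset.prod_nonneg fun j _ => by
    obtain ⟨h1, h2, h3, -⟩ := hB j
    unfold LayerBounds.lip
    positivity

/-- The layer-wise bound. -/
theorem log_sampleCoveringNumber_le_layerwiseCapacity {d k T m L : ℕ} {σ : ℝ → ℝ} {Lσ : ℝ≥0}
    {B : Fin L → LayerBounds} {Bw ε : ℝ} (cls : Fin T) (X : Fin m → Matrix (Fin T) (Fin d) ℝ)
    (hσ : LipschitzWith Lσ σ) (h0 : σ 0 = 0) (hB : ∀ i, (B i).Nonneg) (hBw : 0 ≤ Bw) (hε : 0 < ε)
    (hD : 2 ≤ d * m * T) (hX : ∀ i t, vecNorm (X i t) ≤ 1) :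
    sampleCoveringNumber (tfScalarClass d k L σ B Bw cls) ε X ≠ ⊤ ∧
      Real.log (sampleCoveringNumber (tfScalarClass d k L σ B Bw cls) ε X).toNat
        ≤ 1152 * (layerwiseCapacity B Lσ Bw / ε ^ 2) * Real.log ((d : ℝ) * m * T) := by
  have hL : (0 : ℝ) ≤ Lσ := Lσ.2
  let a := fun i => Bw * lipAfter B Lσ i
  let x₁ := fun i => a i * (Lσ * (B i).BC21)
  let x₂ := fun i => a i * (2 * Lσ * (B i).BC * (B i).BV * (B i).BQK21)
  let x₃ := fun i => a i * (Lσ * (B i).BC * (B i).BV21)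
  have ha : ∀ i, 0 ≤ a i := fun i => mul_nonneg hBw (lipAfter_nonneg hB hL i)
  have hc₁ : ∀ i, 0 ≤ Lσ * (B i).BC21 := fun i => by
    obtain ⟨h1, h2, h3, h4, h5, h6⟩ := hB i; positivity
  have hc₂ : ∀ i, 0 ≤ 2 * Lσ * (B i).BC * (B i).BV * (B i).BQK21 := fun i => by
    obtain ⟨h1, h2, h3, h4, h5, h6⟩ := hB i; positivity
  have hc₃ : ∀ i, 0 ≤ Lσ * (B i).BC * (B i).BV21 := fun i => by
    obtain ⟨h1, h2, h3, h4, h5, h6⟩ := hB i; positivity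
  have hx₁ : ∀ i, 0 ≤ x₁ i := fun i => mul_nonneg (ha i) (hc₁ i)
  have hx₂ : ∀ i, 0 ≤ x₂ i := fun i => mul_nonneg (ha i) (hc₂ i)
  have hx₃ : ∀ i, 0 ≤ x₃ i := fun i => mul_nonneg (ha i) (hc₃ i)
  let f : ℝ → ℝ := fun x => x ^ (2 / 3 : ℝ)
  have hf : ∀ {x}, 0 ≤ x → 0 ≤ f x := fun h => Real.rpow_nonneg h _
  set S := f Bw + ∑ i, (f (x₁ i) + f (x₂ i) + f (x₃ i)) with hS
  have hcap : layerwiseCapacity B Lσ Bw = S ^ 3 := by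
    rw [layerwiseCapacity, hS]
    congr 2
    refine Finset.sum_congr rfl fun i _ => ?_
    simp only [f, x₁, x₂, x₃, mul_add]
    rw [Real.mul_rpow (ha i) (hc₁ i), Real.mul_rpow (ha i) (hc₂ i), Real.mul_rpow (ha i) (hc₃ i)]
  have hsum0 : ∀ i, 0 ≤ f (x₁ i) + f (x₂ i) + f (x₃ i) := fun i =>
    add_nonneg (add_nonneg (hf (hx₁ i)) (hf (hx₂ i))) (hf (hx₃ i))
  have hSi : ∀ i, f (x₁ i) + f (x₂ i) + f (x₃ i) ≤ S := fun i => by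
    have := Finset.single_le_sum (fun j _ => hsum0 j) (Finset.mem_univ i)
    have := hf hBw
    linarith
  have hSw : f Bw ≤ S := le_add_of_nonneg_right (Finset.sum_nonneg fun i _ => hsum0 i)
  have key := exists_scalar_cover (k := k) (n₀ := budget S ε Bw) (n₁ := fun i => budget S ε (x₁ i))
    (n₂ := fun i => budget S ε (x₂ i)) (n₃ := fun i => budget S ε (x₃ i)) (ε := ε) hσ h0 hB
    (r := fun _ => 1) (fun _ => zero_le_one) (fun i W _ Z _ t => vecNorm_block_le_one σ W Z t)
    hD X hX hBw zero_le_one cls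
    (fun W hW i => vecNorm_tfBlock_le (B := B) (r := fun _ => 1)
      (fun i W _ Z _ t => vecNorm_block_le_one σ W Z t) hW (hX i) cls) ?_
  · refine ⟨key.1, key.2.trans (mul_le_mul_of_nonneg_right ?_ (Real.log_nonneg ?_))⟩
    · have h1 : (budget S ε Bw : ℝ) + ∑ i, ((budget S ε (x₁ i) : ℝ) + budget S ε (x₂ i)
          + budget S ε (x₃ i)) ≤ S * (144 * S ^ 2 / ε ^ 2) := by
        nth_rewrite 5 [hS]
        rw [add_mul, Finset.sum_mul]
        refine add_le_add (budget_le hBw) (Finset.sum_le_sum fun i _ => ?_)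
        rw [add_mul, add_mul]
        exact add_le_add (add_le_add (budget_le (hx₁ i)) (budget_le (hx₂ i))) (budget_le (hx₃ i))
      rw [hcap]
      refine (mul_le_mul_of_nonneg_left h1 (by norm_num)).trans_eq (by ring)
    · have : ((2 : ℕ) : ℝ) ≤ (d * m * T : ℕ) := Nat.cast_le.2 hD
      push_cast at this
      linarith
  · have hlip : ∀ i, ∏ j ∈ Finset.Ioi i, blockLip (B j) Lσ 1 = lipAfter B Lσ i := fun i => by
      simp [lipAfter, blockLip, LayerBounds.lip]
    simp only [hlip, Finset.mul_sum]
    have hterm : ∀ i, Bw * (12 * (lipAfter B Lσ i * layerError (B i) Lσ 1 (budget S ε (x₁ i))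
        (budget S ε (x₂ i)) (budget S ε (x₃ i))))
          ≤ (f (x₁ i) + f (x₂ i) + f (x₃ i)) * (ε / S) := fun i => by
      have hm : min 1 ((B i).BV * 1) ≤ 1 := min_le_left _ _
      have h₁ := error_le_of_budget (hx₁ i) hε (S := S)
        (by linarith [hSi i, hf (hx₂ i), hf (hx₃ i)])
      have h₂ := error_le_of_budget (hx₂ i) hε (S := S)
        (by linarith [hSi i, hf (hx₁ i), hf (hx₃ i)])
      have h₃ := error_le_of_budget (hx₃ i) hε (S := S)
        (by linarith [hSi i, hf (hx₁ i), hf (hx₂ i)])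
      rw [add_mul, add_mul]
      refine le_trans ?_ (add_le_add (add_le_add h₁ h₂) h₃)
      have h₄ : 12 * x₁ i * min 1 ((B i).BV * 1) / √(budget S ε (x₁ i) + 1)
          ≤ 12 * x₁ i / √(budget S ε (x₁ i) + 1) := by
        exact div_le_div_of_nonneg_right
          (mul_le_of_le_one_right (mul_nonneg (by norm_num) (hx₁ i)) hm) (Real.sqrt_nonneg _)
      refine le_trans (le_of_eq ?_) (add_le_add_left (add_le_add_left h₄ _) _)
      simp only [layerError, x₁, x₂, x₃, a]
      ring
    refine (add_le_add (Finset.sum_le_sum fun i _ => hterm i)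
      ((error_le_of_budget hBw hε hSw).trans_eq' (by rw [one_mul]))).trans ?_
    rw [← Finset.sum_mul, ← add_mul, add_comm, mul_div_assoc', mul_comm, mul_div_assoc]
    exact mul_le_of_le_one_right hε.le (div_self_le_one S)

/-! ### Uniform bounds -/

/-- The simplified bound. -/
theorem log_sampleCoveringNumber_le_uniform {d k T m L : ℕ} {σ : ℝ → ℝ} {Lσ : ℝ≥0}
    {C₂ C₂₁ BX Bw ε : ℝ} (cls : Fin T) (X : Fin m → Matrix (Fin T) (Fin d) ℝ)
    (hσ : LipschitzWith Lσ σ) (h0 : σ 0 = 0) (hC₂ : 0 ≤ C₂) (hC₂₁ : 0 ≤ C₂₁) (hBw : 0 ≤ Bw)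
    (hε : 0 < ε) (hL : 1 ≤ L) (hD : 2 ≤ d * m * T) (hX : ∀ i t, vecNorm (X i t) ≤ BX) :
    sampleCoveringNumber (tfScalarClass d k L σ (fun _ => LayerBounds.uniform C₂ C₂₁) Bw cls) ε X
        ≠ ⊤ ∧
      Real.log (sampleCoveringNumber
          (tfScalarClass d k L σ (fun _ => LayerBounds.uniform C₂ C₂₁) Bw cls) ε X).toNat
        ≤ (32 : ℕ) * (2 * max 1 C₂ * max 1 (Lσ : ℝ)) ^ (32 * L)
          * (BX ^ 2 * max 1 BX ^ 4 * Bw ^ 2 * C₂₁ ^ 2 / ε ^ 2) * Real.log ((d : ℝ) * m * T) := by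
  obtain ⟨L, rfl⟩ : ∃ l, L = l + 1 := ⟨L - 1, by omega⟩
  have hm : 0 < m := Nat.pos_of_ne_zero (by rintro rfl; simp at hD)
  have hBX : 0 ≤ BX := (vecNorm_nonneg _).trans (hX ⟨0, hm⟩ cls)
  have hLσ : (0 : ℝ) ≤ Lσ := Lσ.2
  set K := max 1 C₂ * max 1 (Lσ : ℝ) with hK
  have hmC : 1 ≤ max 1 C₂ := le_max_left _ _
  have hmL : 1 ≤ max 1 (Lσ : ℝ) := le_max_left _ _
  have hK1 : 1 ≤ K := one_le_mul_of_one_le_of_one_le hmC hmL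
  have hCK : C₂ ≤ K := (le_max_right 1 C₂).trans (le_mul_of_one_le_right (by positivity) hmL)
  have hLCK : Lσ * C₂ ≤ K := by
    rw [hK, mul_comm]
    exact mul_le_mul (le_max_right _ _) (le_max_right _ _) hLσ (by positivity)
  have hLCCK : Lσ * C₂ * C₂ ≤ K ^ 2 := by
    rw [sq]; exact mul_le_mul hLCK hCK hC₂ (by positivity)
  have hLCK2 : Lσ * C₂ ≤ K ^ 2 := hLCK.trans (le_self_pow₀ hK1 two_ne_zero)
  set B : Fin (L + 1) → LayerBounds := fun _ => LayerBounds.uniform C₂ C₂₁ with hBdef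
  have hB : ∀ i, (B i).Nonneg := fun _ => ⟨hC₂, hC₂, hC₂, hC₂₁, hC₂₁, hC₂₁⟩
  -- Only the input may leave the unit ball. After a block both the projection bound and the growth
  -- by `K ^ 2` per block hold, and the latter retains the factor `BX`.
  let r : Fin (L + 2) → ℝ := fun i => if i = 0 then BX else min 1 (BX * K ^ (2 * (i : ℕ)))
  have hr0 : ∀ i, 0 ≤ r i := fun i => by
    simp only [r]; split_ifs
    · exact hBX
    · positivity
  have hrK : ∀ i, r i ≤ BX * K ^ (2 * (i : ℕ)) := fun i => by
    simp only [r]; split_ifs with h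
    · simp [h]
    · exact min_le_right _ _
  have hr1 : ∀ i, i ≠ 0 → r i ≤ 1 := fun i hi => by
    simp only [r, if_neg hi]; exact min_le_left _ _
  have hr : ∀ i, ∀ W : LayerWeights d k, W.Obeys (B i) → ∀ Z : Matrix (Fin T) (Fin d) ℝ,
      (∀ t, vecNorm (Z t) ≤ r i.castSucc) → ∀ t, vecNorm (block σ W Z t) ≤ r i.succ := by
    intro i W hW Z hZ t
    simp only [r, if_neg (Fin.succ_ne_zero i)]
    refine le_min (vecNorm_block_le_one σ W Z t) ((vecNorm_block_le hσ h0 hW hZ t).trans ?_)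
    calc min C₂ C₂₁ * (Lσ * (C₂ * r i.castSucc)) ≤ C₂ * (Lσ * (C₂ * r i.castSucc)) :=
          mul_le_mul_of_nonneg_right (min_le_left _ _) (by have := hr0 i.castSucc; positivity)
      _ = Lσ * C₂ * C₂ * r i.castSucc := by ring
      _ ≤ K ^ 2 * (BX * K ^ (2 * (i : ℕ))) :=
          mul_le_mul hLCCK (hrK _) (hr0 _) (by positivity)
      _ = BX * K ^ (2 * (i.succ : ℕ)) := by rw [Fin.val_succ]; ring
  set ρ := BX * max 1 BX ^ 2 * K ^ (2 * L) with hρ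
  have hM1 : 1 ≤ max 1 BX := le_max_left _ _
  have hM : 1 ≤ max 1 BX ^ 2 := one_le_pow₀ hM1
  have hρ0 : 0 ≤ ρ := by positivity
  have hrρ : ∀ i : Fin (L + 1), r i.castSucc ≤ ρ := fun i => by
    refine (hrK _).trans ?_
    rw [hρ]
    have hi : (i.castSucc : ℕ) ≤ L := by simpa using Nat.lt_succ_iff.1 i.2
    exact mul_le_mul (le_mul_of_one_le_right hBX hM)
      (pow_le_pow_right₀ hK1 (by omega)) (by positivity) (by positivity)
  -- The attention error is cubic in the radius. At the input this costs the extra `max 1 BX ^ 2` in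
  -- `ρ`; later radii are at most `1`, where the cube is below the radius.
  have hr3ρ : ∀ i : Fin (L + 1), r i.castSucc ^ 3 ≤ ρ := fun i => by
    by_cases h : i.castSucc = 0
    · have : r i.castSucc = BX := by simp only [r, if_pos h]
      rw [this, hρ, pow_succ', mul_assoc]
      refine mul_le_mul_of_nonneg_left ?_ hBX
      calc BX ^ 2 ≤ max 1 BX ^ 2 := pow_le_pow_left₀ hBX (le_max_right _ _) 2
        _ ≤ _ := le_mul_of_one_le_right (by positivity) (one_le_pow₀ hK1)
    · exact (pow_le_of_le_one (hr0 _) (hr1 _ h) three_ne_zero).trans (hrρ i)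
  -- The product runs over blocks after `i`, so the input radius never enters and each factor is at
  -- most `5 * K ^ 3 ≤ (2 * K) ^ 3`.
  have hlip : ∀ i : Fin (L + 1),
      ∏ j ∈ Finset.Ioi i, blockLip (B j) Lσ (r j.castSucc) ≤ (2 * K) ^ (3 * (L + 1)) := fun i => by
    have h1 : ∀ j ∈ Finset.Ioi i, blockLip (B j) Lσ (r j.castSucc) ≤ (2 * K) ^ 3 := fun j hj => by
      have hj0 : j.castSucc ≠ 0 := by
        have : i < j := Finset.mem_Ioi.1 hj
        rw [Ne, Fin.ext_iff]
        simp only [Fin.val_castSucc, Fin.val_zero]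
        omega
      have h2 : r j.castSucc ^ 2 ≤ 1 := pow_le_one₀ (hr0 _) (hr1 _ hj0)
      calc Lσ * C₂ * C₂ * (1 + 4 * r j.castSucc ^ 2 * C₂) ≤ K ^ 2 * (K + 4 * 1 * K) := by
            gcongr
        _ ≤ (2 * K) ^ 3 := by
            have : 0 ≤ K ^ 3 := by positivity
            linarith
    have h0 : ∀ j ∈ Finset.Ioi i, 0 ≤ blockLip (B j) Lσ (r j.castSucc) := fun j _ => by
      simp only [blockLip, hBdef, LayerBounds.uniform]; positivity
    refine (Finset.prod_le_prod h0 h1).trans ?_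
    rw [Finset.prod_const, ← pow_mul]
    refine pow_le_pow_right₀ (by linarith) (Nat.mul_le_mul_left 3 ?_)
    exact (Finset.card_le_univ _).trans_eq (Fintype.card_fin _)
  have hout : ∀ W : Fin (L + 1) → LayerWeights d k, (∀ i, (W i).Obeys (B i)) → ∀ i,
      vecNorm (tfBlock σ (L + 1) W (X i) cls) ≤ K ^ 2 * ρ * C₂₁ := fun W hW i => by
    have hin := vecNorm_tfBlock_le (B := fun i : Fin L => B i.castSucc)
      (r := fun i => r i.castSucc) (fun i => hr i.castSucc) (fun i => hW i.castSucc) (hX i)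
    refine (vecNorm_block_le hσ h0 (hW (Fin.last L)) hin cls).trans ?_
    calc min C₂ C₂₁ * (Lσ * (C₂ * r (Fin.last L).castSucc))
        ≤ C₂₁ * (Lσ * (C₂ * r (Fin.last L).castSucc)) :=
          mul_le_mul_of_nonneg_right (min_le_right _ _)
            (by have := hr0 (Fin.last L).castSucc; positivity)
      _ = Lσ * C₂ * r (Fin.last L).castSucc * C₂₁ := by ring
      _ ≤ K ^ 2 * ρ * C₂₁ := by
          have := hrρ (Fin.last L)
          have := hr0 (Fin.last L).castSucc
          gcongr
  set Q := Bw * (BX * max 1 BX ^ 2) * C₂₁ with hQ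
  have hQ0 : 0 ≤ Q := by positivity
  -- In terms of `P = (2 * K) ^ (L + 1)`, the number of layers costs `P`, the Lipschitz product `P ^
  -- 3`, and `K ^ 2` and `ρ` each `P ^ 2`. The remaining constant `60` is below `P ^ 6`.
  set H := (2 * K) ^ (14 * (L + 1)) * Q with hH
  have hH0 : 0 ≤ H := by positivity
  set n : ℕ := ⌊H ^ 2 / ε ^ 2⌋₊ with hn
  have hnle : (n : ℝ) ≤ H ^ 2 / ε ^ 2 := Nat.floor_le (by positivity)
  have hHn : H / √(n + 1) ≤ ε := by
    rw [div_le_iff₀ (by positivity), ← div_le_iff₀' hε]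
    refine Real.le_sqrt_of_sq_le ?_
    rw [div_pow]
    exact (Nat.lt_floor_add_one _).le
  have herr : ∀ i : Fin (L + 1),
      layerError (B i) Lσ (r i.castSucc) n n n ≤ 4 * K ^ 2 * ρ * C₂₁ / √(n + 1) := fun i => by
    have h1 := hr0 i.castSucc
    have h2 := hrρ i
    have h3 := hr3ρ i
    have e1 : Lσ * min 1 (C₂ * r i.castSucc) * C₂₁ ≤ K ^ 2 * ρ * C₂₁ := by
      refine mul_le_mul_of_nonneg_right ?_ hC₂₁
      calc Lσ * min 1 (C₂ * r i.castSucc) ≤ Lσ * (C₂ * r i.castSucc) :=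
            mul_le_mul_of_nonneg_left (min_le_right _ _) hLσ
        _ = Lσ * C₂ * r i.castSucc := by ring
        _ ≤ K ^ 2 * ρ := by gcongr
    have e2 : r i.castSucc ^ 3 * (2 * Lσ * C₂ * C₂ * C₂₁) ≤ 2 * (K ^ 2 * ρ * C₂₁) := by
      calc _ = 2 * (Lσ * C₂ * C₂ * r i.castSucc ^ 3 * C₂₁) := by ring
        _ ≤ _ := by gcongr
    have e3 : r i.castSucc * (Lσ * C₂ * C₂₁) ≤ K ^ 2 * ρ * C₂₁ := by
      calc _ = Lσ * C₂ * r i.castSucc * C₂₁ := by ring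
        _ ≤ _ := by gcongr
    change Lσ * min 1 (C₂ * r i.castSucc) * C₂₁ / √(n + 1)
      + r i.castSucc ^ 3 * (2 * Lσ * C₂ * C₂ * C₂₁) / √(n + 1)
      + r i.castSucc * (Lσ * C₂ * C₂₁) / √(n + 1) ≤ _
    rw [← add_div, ← add_div]
    gcongr
    linarith
  have hL2 : ((L + 1 : ℕ) : ℝ) ≤ (2 * K) ^ (L + 1) := by
    have h1 : ((L + 1 : ℕ) : ℝ) ≤ 2 ^ (L + 1) := by exact_mod_cast (Nat.lt_two_pow_self).le
    exact h1.trans (pow_le_pow_left₀ (by norm_num) (by linarith) _)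
  have key := exists_scalar_cover (k := k) (n₀ := n) (n₁ := fun _ => n)
    (n₂ := fun _ => n) (n₃ := fun _ => n) (ε := ε) hσ h0 hB hr0 hr hD X hX hBw
    (by positivity : 0 ≤ K ^ 2 * ρ * C₂₁) cls hout ?_
  · refine ⟨key.1, key.2.trans (mul_le_mul_of_nonneg_right ?_ (Real.log_nonneg ?_))⟩
    · rw [Finset.sum_const, Finset.card_univ, Fintype.card_fin, nsmul_eq_mul, mul_assoc 2, ← hK]
      have hn0 : (0 : ℝ) ≤ n := n.cast_nonneg
      have h1 : (1 : ℝ) ≤ ((L + 1 : ℕ) : ℝ) := by exact_mod_cast Nat.le_add_left 1 L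
      have h2 : (1 : ℝ) ≤ 2 * K := by linarith
      -- The exponent `29` is twice `14` from `H ^ 2`, plus `1` from bounding the number of layers
      -- by `(2 * K) ^ (L + 1)`; it is raised to `32` so that one constant serves as both factor and
      -- exponent.
      calc 8 * (n + ((L + 1 : ℕ) : ℝ) * (n + n + n)) ≤ 32 * (((L + 1 : ℕ) : ℝ) * n) := by
            linarith [mul_le_mul_of_nonneg_right h1 hn0]
        _ ≤ 32 * ((2 * K) ^ (L + 1) * (H ^ 2 / ε ^ 2)) := by gcongr
        _ = 32 * (2 * K) ^ (29 * (L + 1)) * (Q ^ 2 / ε ^ 2) := by rw [hH]; ring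
        _ ≤ 32 * (2 * K) ^ (32 * (L + 1)) * (Q ^ 2 / ε ^ 2) := by
            gcongr
            norm_num
        _ = _ := by rw [hQ]; push_cast; ring
    · have : ((2 : ℕ) : ℝ) ≤ (d * m * T : ℕ) := Nat.cast_le.2 hD
      push_cast at this
      linarith
  · refine le_trans ?_ hHn
    set s := √((n : ℝ) + 1)
    have hs : 0 < s := Real.sqrt_pos.2 (by positivity)
    set P := (2 * K) ^ (L + 1) with hP
    have h2K : 2 ≤ 2 * K := by linarith
    have hP2 : 2 ≤ P := h2K.trans (le_self_pow₀ (by linarith) (Nat.succ_ne_zero L))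
    have hKP : K ^ 2 ≤ P ^ 2 := by
      refine pow_le_pow_left₀ (by positivity) (le_trans (by linarith)
        (le_self_pow₀ (by linarith : 1 ≤ 2 * K) (Nat.succ_ne_zero L))) 2
    have hρP : ρ ≤ BX * max 1 BX ^ 2 * P ^ 2 := by
      rw [hρ, hP, ← pow_mul]
      refine mul_le_mul_of_nonneg_left ?_ (by positivity)
      calc K ^ (2 * L) ≤ (2 * K) ^ (2 * L) := pow_le_pow_left₀ (by positivity) (by linarith) _
        _ ≤ _ := pow_le_pow_right₀ (by linarith) (by omega)
    have herr0 : ∀ i : Fin (L + 1), 0 ≤ layerError (B i) Lσ (r i.castSucc) n n n := fun i => by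
      have := hr0 i.castSucc
      simp only [layerError, hBdef, LayerBounds.uniform]
      positivity
    have hsum : ∑ i, (∏ j ∈ Finset.Ioi i, blockLip (B j) Lσ (r j.castSucc))
        * layerError (B i) Lσ (r i.castSucc) n n n ≤ P * (P ^ 3 * (4 * K ^ 2 * ρ * C₂₁ / s)) := by
      refine (Finset.sum_le_card_nsmul _ _ (P ^ 3 * (4 * K ^ 2 * ρ * C₂₁ / s)) fun i _ =>
        mul_le_mul ((hlip i).trans_eq (by rw [hP, ← pow_mul, mul_comm 3])) (herr i) (herr0 i)
          (by positivity)).trans ?_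
      rw [Finset.card_univ, Fintype.card_fin, nsmul_eq_mul]
      exact mul_le_mul_of_nonneg_right hL2 (by positivity)
    have h60 : 60 * P ^ 8 ≤ P ^ 14 := by
      have : (2 : ℝ) ^ 6 ≤ P ^ 6 := pow_le_pow_left₀ (by norm_num) hP2 6
      calc 60 * P ^ 8 ≤ P ^ 6 * P ^ 8 := by gcongr; linarith
        _ = P ^ 14 := by ring
    have h1P : 1 ≤ P ^ 4 := one_le_pow₀ (by linarith)
    have hX0 : 0 ≤ K ^ 2 * ρ * C₂₁ * Bw / s := by positivity
    calc _ ≤ Bw * (12 * (P * (P ^ 3 * (4 * K ^ 2 * ρ * C₂₁ / s))))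
          + 12 * (K ^ 2 * ρ * C₂₁ * Bw) / s :=
          add_le_add_left (mul_le_mul_of_nonneg_left
            (mul_le_mul_of_nonneg_left hsum (by norm_num)) hBw) _
      _ = (48 * P ^ 4 + 12) * (K ^ 2 * ρ * C₂₁ * Bw / s) := by ring
      _ ≤ (60 * P ^ 4) * (K ^ 2 * ρ * C₂₁ * Bw / s) :=
          mul_le_mul_of_nonneg_right (by linarith) hX0
      _ ≤ (60 * P ^ 4) * (P ^ 2 * (BX * max 1 BX ^ 2 * P ^ 2) * C₂₁ * Bw / s) := by gcongr
      _ = 60 * P ^ 8 * Q / s := by rw [hQ]; ring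
      _ ≤ P ^ 14 * Q / s := by gcongr
      _ = H / s := by rw [hH, hP, ← pow_mul, mul_comm 14]

end DeepTransformer

theorem mainTheorem3 :
    -- layer-wise bound, for inputs with rows in the unit ball
    (∃ c : ℝ, 0 < c ∧
      ∀ (d k T m L : ℕ) (σ : ℝ → ℝ) (Lσ : ℝ≥0) (B : Fin L → DeepTransformer.LayerBounds)
        (Bw ε : ℝ) (cls : Fin T) (X : Fin m → Matrix (Fin T) (Fin d) ℝ),
        LipschitzWith Lσ σ → σ 0 = 0 →
        (∀ i, (B i).Nonneg) → 0 ≤ Bw → 0 < ε → 2 ≤ d * m * T →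
        (∀ i t, DeepTransformer.vecNorm (X i t) ≤ 1) →
        DeepTransformer.sampleCoveringNumber
            (DeepTransformer.tfScalarClass d k L σ B Bw cls) ε X ≠ ⊤ ∧
        Real.log (DeepTransformer.sampleCoveringNumber
            (DeepTransformer.tfScalarClass d k L σ B Bw cls) ε X).toNat ≤
          c * (DeepTransformer.layerwiseCapacity B Lσ Bw / ε ^ 2)
            * Real.log ((d : ℝ) * m * T)) ∧
    -- bound for uniform spectral norm bounds `C2` and `(2,1)` norm bounds `C21`
    (∃ c : ℕ, 0 < c ∧
      ∀ (d k T m L : ℕ) (σ : ℝ → ℝ) (Lσ : ℝ≥0) (C2 C21 BX Bw ε : ℝ) (cls : Fin T)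
        (X : Fin m → Matrix (Fin T) (Fin d) ℝ),
        LipschitzWith Lσ σ → σ 0 = 0 →
        0 ≤ C2 → 0 ≤ C21 → 0 ≤ Bw → 0 < ε → 1 ≤ L → 2 ≤ d * m * T →
        (∀ i t, DeepTransformer.vecNorm (X i t) ≤ BX) →
        DeepTransformer.sampleCoveringNumber
            (DeepTransformer.tfScalarClass d k L σ
              (fun _ => DeepTransformer.LayerBounds.uniform C2 C21) Bw cls) ε X ≠ ⊤ ∧
        Real.log (DeepTransformer.sampleCoveringNumber
            (DeepTransformer.tfScalarClass d k L σ
              (fun _ => DeepTransformer.LayerBounds.uniform C2 C21) Bw cls) ε X).toNat ≤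
          c * (2 * max 1 C2 * max 1 (Lσ : ℝ)) ^ (c * L)
            * (BX ^ 2 * max 1 BX ^ 4 * Bw ^ 2 * C21 ^ 2 / ε ^ 2)
            * Real.log ((d : ℝ) * m * T)) :=
  ⟨⟨1152, by norm_num, fun _ _ _ _ _ _ _ _ _ _ cls X hσ h0 hB hBw hε hD hX =>
      DeepTransformer.log_sampleCoveringNumber_le_layerwiseCapacity cls X hσ h0 hB hBw hε hD hX⟩,
    ⟨32, by norm_num, fun _ _ _ _ _ _ _ _ _ _ _ _ cls X hσ h0 hC₂ hC₂₁ hBw hε hL hD hX =>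
      DeepTransformer.log_sampleCoveringNumber_le_uniform cls X hσ h0 hC₂ hC₂₁ hBw hε hL hD hX⟩⟩
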